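/- All graphs are finite and simple. A \emph{subdivision} of a graph $K$ is a graph obtained from $K$ by repeatedly subdividing edges (possibly zero times), that is, by replacing the edges of $K$ by internally vertex-disjoint paths of length at least one with the same ends. A graph is \emph{ISK4-free} if none of its induced subgraphs is a subdivision of the complete graph $K_4$, and \emph{series-parallel} if none of its subgraphs, induced or not, is a subdivision of $K_4$. A \emph{star cutset} of a graph $G$ is a set $C\subseteq V(G)$ such that $G\setminus C$ is disconnected and $C$ contains a vertex $c$ adjacent to all other vertices of $C$. If $G$ is an ISK4-free graph of girth at least $5$ (i.e. $G$ has no cycle of length $3$ or $4$), then $G$ is series-parallel or $G$ has a star cutset. -/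

import Mathlib

namespace SimpleGraph

universe u v

/-- A presentation of the graph `H` as a subdivision of the graph `K`: `H` arises from `K` by
replacing each edge `ab` of `K` by a path (of length at least one) joining the branch vertices of
`a` and `b`. The paths are pairwise internally disjoint, have no branch vertex in their interior,
and together with the branch vertices they make up all of `H`. -/
structure SubdivisionModel {W : Type v} {V : Type u} (K : SimpleGraph W) (H : SimpleGraph V) where
  /-- The vertices of `K`, seen in `H`. -/
  branch : W ↪ V
  /-- The path of `H` that replaces the edge `ab` of `K`. -/
  path : ∀ a b : W, K.Adj a b → H.Walk (branch a) (branch b)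
  isPath : ∀ (a b : W) (h : K.Adj a b), (path a b h).IsPath
  /-- The path only depends on the edge, not on its orientation. -/
  path_symm : ∀ (a b : W) (h : K.Adj a b), path b a h.symm = (path a b h).reverse
  /-- The only branch vertices on a path are its two ends. -/
  branch_mem : ∀ (a b c : W) (h : K.Adj a b),
    branch c ∈ (path a b h).support → c = a ∨ c = b
  /-- Paths that replace distinct edges only meet in branch vertices. -/
  disjoint : ∀ (a b c d : W) (h : K.Adj a b) (h' : K.Adj c d), s(a, b) ≠ s(c, d) →
    ∀ x, x ∈ (path a b h).support → x ∈ (path c d h').support → ∃ w, branch w = x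
  /-- There are no other vertices. -/
  vertex_cover : ∀ x : V,
    (∃ w, branch w = x) ∨ ∃ (a b : W) (h : K.Adj a b), x ∈ (path a b h).support
  /-- There are no other edges. -/
  edge_cover : ∀ x y : V, H.Adj x y →
    ∃ (a b : W) (h : K.Adj a b), s(x, y) ∈ (path a b h).edges

/-- `H` is (isomorphic to) a subdivision of `K`. -/
def IsSubdivisionOf {V : Type u} {W : Type v} (H : SimpleGraph V) (K : SimpleGraph W) : Prop :=
  Nonempty (SubdivisionModel K H)

/-- No induced subgraph of `G` is a subdivision of `K₄`. -/
def ISK4Free {V : Type u} (G : SimpleGraph V) : Prop :=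
  ∀ s : Set V, ¬ (G.induce s).IsSubdivisionOf (completeGraph (Fin 4))

/-- No subgraph of `G`, induced or not, is a subdivision of `K₄`. -/
def IsSeriesParallel {V : Type u} (G : SimpleGraph V) : Prop :=
  ∀ H : G.Subgraph, ¬ H.coe.IsSubdivisionOf (completeGraph (Fin 4))

/-- Deleting `C` leaves a disconnected graph: some two of the remaining vertices are not joined by
a path that avoids `C`. (The graph without vertices does not count as disconnected.) -/
def IsCutset {V : Type u} (G : SimpleGraph V) (C : Set V) : Prop :=
  ¬ (G.induce Cᶜ).Preconnected

/-- A cutset with a center: a vertex of `C` adjacent to all other vertices of `C`. -/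
def IsStarCutset {V : Type u} (G : SimpleGraph V) (C : Set V) : Prop :=
  G.IsCutset C ∧ ∃ c ∈ C, ∀ x ∈ C, x ≠ c → G.Adj c x

end SimpleGraph

/-! ### Short cycles, connected sets, `K₄`-minors and induced paths. -/

namespace SimpleGraph

section Basics

variable {V : Type*} {G : SimpleGraph V}

/-! Suppose `G` is not series-parallel. Because `K₄` is cubic, a set of vertices has a `K₄`-minor
exactly when it contains a subdivision of `K₄` (`HasK4Minor.exists_model`,
`K4Model.hasK4Minor_verts`). Consider an inclusion-minimal such set; it is spanned by a subdivision.
A chord usually makes some vertex superfluous. The only chords that survive minimality and girth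
five run from a branch vertex to the interior of a path between two other branch vertices. Without
chords the subdivision is induced, which is forbidden; with one, its branch vertex is the center of
a wheel with four spokes. So every set with a `K₄`-minor contains a wheel with at least four spokes
(`exists_wheel_of_hasK4Minor`), and none induces a graph of maximum degree at most three. This last
fact, `false_of_hasK4Minor_of_degree_le_three`, is the working tool: four branch sets and a degree
bound suffice for a contradiction, and no induced subdivision has to be written down.

Now take a wheel with a shortest hole and one of its sectors. No vertex outside has three neighbours
on that sector, or a shorter wheel would appear (`exists_thin_sector`). Keep the center `x` and this
sector `h 0, …, h a`, and choose the hole through it with the fewest spokes. Three spokes force a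
fourth, so there are further spoke ends `h b` and `h c`.

The closed neighbourhood of `x` is the desired star cutset. Otherwise a path avoiding it leads from
the sector between `h b` and `h c` to the interior of the first sector. The vertex `v` where it
escapes is joined by induced tails to both `h b` and `h c`, and has a neighbour on the hole outside
their sector (`IsFrame.exists_tails`). According to the position of the neighbours of `v`, either a
`K₄`-minor of maximum degree three appears, or the hole can be rerouted through `v` so as to lose a
spoke (`IsFrame.false_of_tails`). -/

lemma not_triangle_of_five_le_egirth (hg : 5 ≤ G.egirth) {a b c : V} (hab : G.Adj a b)
    (hbc : G.Adj b c) (hca : G.Adj c a) : False := by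
  have hc : (Walk.cons hab (Walk.cons hbc (Walk.cons hca Walk.nil))).IsCycle := by
    rw [Walk.cons_isCycle_iff]
    have := hab.ne; have := hbc.ne; have := hca.ne
    simp_all [Walk.cons_isPath_iff, ne_comm]
  have := le_egirth.mp hg _ _ hc
  simp at this
  norm_num at this

lemma not_four_cycle_of_five_le_egirth (hg : 5 ≤ G.egirth) {a b c d : V} (hab : G.Adj a b)
    (hbc : G.Adj b c) (hcd : G.Adj c d) (hda : G.Adj d a) (hac : a ≠ c) (hbd : b ≠ d) :
    False := by
  have hc : (Walk.cons hab (Walk.cons hbc (Walk.cons hcd (Walk.cons hda Walk.nil)))).IsCycle := by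
    rw [Walk.cons_isCycle_iff]
    have := hab.ne; have := hbc.ne; have := hcd.ne; have := hda.ne
    simp_all [Walk.cons_isPath_iff, ne_comm]
  have := le_egirth.mp hg _ _ hc
  simp at this
  norm_num at this

lemma connected_induce_singleton (v : V) : (G.induce ({v} : Set V)).Connected := by
  have : Nonempty ({v} : Set V) := ⟨⟨v, rfl⟩⟩
  refine ⟨?_⟩
  rintro ⟨x, rfl⟩ ⟨y, rfl⟩
  exact Reachable.refl _

lemma exists_walk_of_induce_walk {B : Set V} {x y : B} (p : (G.induce B).Walk x y) :
    ∃ q : G.Walk (x : V) y, ∀ v ∈ q.support, v ∈ B := by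
  induction p with
  | @nil u => exact ⟨Walk.nil, by simp [u.2]⟩
  | @cons u v w h p ih =>
    obtain ⟨q, hq⟩ := ih
    refine ⟨Walk.cons (induce_adj.mp h) q, fun z hz => ?_⟩
    rw [Walk.support_cons, List.mem_cons] at hz
    rcases hz with rfl | hz
    · exact u.2
    · exact hq z hz

lemma exists_walk_of_connected_induce {B : Set V} (hB : (G.induce B).Connected) {x y : V}
    (hx : x ∈ B) (hy : y ∈ B) : ∃ p : G.Walk x y, p.IsPath ∧ ∀ v ∈ p.support, v ∈ B := by
  classical
  obtain ⟨p⟩ := hB.preconnected ⟨x, hx⟩ ⟨y, hy⟩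
  obtain ⟨q, hq⟩ := exists_walk_of_induce_walk p
  exact ⟨q.bypass, Walk.bypass_isPath _, fun v hv =>
    hq v (Walk.support_bypass_subset_support _ hv)⟩

/-- The union of two connected sets joined by an edge is connected. -/
lemma connected_induce_union_of_adj {s t : Set V} (hs : (G.induce s).Connected)
    (ht : (G.induce t).Connected) (h : ∃ x ∈ s, ∃ y ∈ t, G.Adj x y) :
    (G.induce (s ∪ t)).Connected := by
  obtain ⟨x, hx, y, hy, hxy⟩ := h
  exact connected_induce_union hs.preconnected ht.preconnected hx hy hxy

/-- The vertices `f k` with `i ≤ k < j`. -/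
def arc (f : ℕ → V) (i j : ℕ) : Set V := {v | ∃ k, i ≤ k ∧ k < j ∧ f k = v}

lemma mem_arc {f : ℕ → V} {i j k : ℕ} (h : i ≤ k) (h' : k < j) : f k ∈ arc f i j :=
  ⟨k, h, h', rfl⟩

lemma connected_induce_arc {f : ℕ → V} {i j : ℕ} (hij : i < j)
    (h : ∀ k, i ≤ k → k + 1 < j → G.Adj (f k) (f (k + 1))) : (G.induce (arc f i j)).Connected := by
  obtain ⟨n, rfl⟩ : ∃ n, j = i + n + 1 := ⟨j - i - 1, by omega⟩
  clear hij
  induction n with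
  | zero =>
    have : arc f i (i + 0 + 1) = {f i} := by
      ext v
      constructor
      · rintro ⟨k, hk, hk', rfl⟩
        obtain rfl : k = i := by omega
        rfl
      · rintro rfl
        exact mem_arc le_rfl (by omega)
    rw [this]
    exact connected_induce_singleton _
  | succ n ih =>
    have : arc f i (i + (n + 1) + 1) = arc f i (i + n + 1) ∪ {f (i + n + 1)} := by
      ext v
      constructor
      · rintro ⟨k, hk, hk', rfl⟩
        rcases Nat.lt_or_ge k (i + n + 1) with h1 | h1
        · exact Or.inl (mem_arc hk h1)
        · obtain rfl : k = i + n + 1 := by omega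
          exact Or.inr rfl
      · rintro (⟨k, hk, hk', rfl⟩ | rfl)
        · exact mem_arc hk (by omega)
        · exact mem_arc (by omega) (by omega)
    rw [this]
    refine connected_induce_union_of_adj (ih fun k hk hk' => h k hk (by omega))
      (connected_induce_singleton _) ⟨f (i + n), mem_arc (by omega) (by omega), _, rfl, ?_⟩
    exact h _ (by omega) (by omega)

/-- Four disjoint connected sets inside `S`, pairwise joined by edges: a `K₄`-minor of the
subgraph induced by `S`. -/
def HasK4Minor (G : SimpleGraph V) (S : Set V) : Prop :=
  ∃ B : Fin 4 → Set V, (∀ i, B i ⊆ S) ∧ (∀ i, (G.induce (B i)).Connected) ∧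
    (∀ i j, i ≠ j → ∀ v, v ∈ B i → v ∉ B j) ∧
    ∀ i j, i ≠ j → ∃ x ∈ B i, ∃ y ∈ B j, G.Adj x y

lemma HasK4Minor.mono {S T : Set V} (h : G.HasK4Minor S) (hST : S ⊆ T) : G.HasK4Minor T := by
  obtain ⟨B, h1, h2⟩ := h
  exact ⟨B, fun i => (h1 i).trans hST, h2⟩

lemma hasK4Minor_of_sets (A B C D : Set V)
    (hA : (G.induce A).Connected) (hB : (G.induce B).Connected)
    (hC : (G.induce C).Connected) (hD : (G.induce D).Connected)
    (dAB : ∀ v ∈ A, v ∉ B) (dAC : ∀ v ∈ A, v ∉ C) (dAD : ∀ v ∈ A, v ∉ D)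
    (dBC : ∀ v ∈ B, v ∉ C) (dBD : ∀ v ∈ B, v ∉ D) (dCD : ∀ v ∈ C, v ∉ D)
    (eAB : ∃ x ∈ A, ∃ y ∈ B, G.Adj x y) (eAC : ∃ x ∈ A, ∃ y ∈ C, G.Adj x y)
    (eAD : ∃ x ∈ A, ∃ y ∈ D, G.Adj x y) (eBC : ∃ x ∈ B, ∃ y ∈ C, G.Adj x y)
    (eBD : ∃ x ∈ B, ∃ y ∈ D, G.Adj x y) (eCD : ∃ x ∈ C, ∃ y ∈ D, G.Adj x y) :
    G.HasK4Minor (A ∪ B ∪ C ∪ D) := by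
  have sw : ∀ {X Y : Set V}, (∃ x ∈ X, ∃ y ∈ Y, G.Adj x y) → ∃ x ∈ Y, ∃ y ∈ X, G.Adj x y :=
    fun ⟨x, hx, y, hy, h⟩ => ⟨y, hy, x, hx, h.symm⟩
  have sd : ∀ {X Y : Set V}, (∀ v ∈ X, v ∉ Y) → ∀ v ∈ Y, v ∉ X :=
    fun h v hY hX => h v hX hY
  refine ⟨![A, B, C, D], ?_, ?_, ?_, ?_⟩
  · intro i v hv
    fin_cases i <;> simp at hv <;> simp [hv]
  · intro i
    fin_cases i <;> assumption
  · intro i j hij v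
    fin_cases i <;> fin_cases j <;>
      first
        | exact absurd rfl hij
        | exact dAB v | exact dAC v | exact dAD v | exact dBC v | exact dBD v | exact dCD v
        | exact sd dAB v | exact sd dAC v | exact sd dAD v
        | exact sd dBC v | exact sd dBD v | exact sd dCD v
  · intro i j hij
    fin_cases i <;> fin_cases j <;>
      first
        | exact absurd rfl hij
        | exact eAB | exact eAC | exact eAD | exact eBC | exact eBD | exact eCD
        | exact sw eAB | exact sw eAC | exact sw eAD
        | exact sw eBC | exact sw eBD | exact sw eCD

/-- The vertices `g 0, …, g s` are distinct and induce a path, in this order. -/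
structure IsInducedPath (G : SimpleGraph V) (g : ℕ → V) (s : ℕ) : Prop where
  ne : ∀ i j, i < j → j ≤ s → g i ≠ g j
  adj_iff : ∀ i j, i < j → j ≤ s → (G.Adj (g i) (g j) ↔ j = i + 1)

lemma IsInducedPath.inj {g : ℕ → V} {s : ℕ} (h : G.IsInducedPath g s) {i j : ℕ} (hi : i ≤ s)
    (hj : j ≤ s) (hij : g i = g j) : i = j := by
  rcases Nat.lt_trichotomy i j with h1 | h1 | h1
  · exact absurd hij (h.ne i j h1 hj)
  · exact h1
  · exact absurd hij.symm (h.ne j i h1 hi)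

lemma IsInducedPath.adj_iff' {g : ℕ → V} {s : ℕ} (h : G.IsInducedPath g s) {i j : ℕ} (hi : i ≤ s)
    (hj : j ≤ s) : G.Adj (g i) (g j) ↔ j = i + 1 ∨ i = j + 1 := by
  rcases Nat.lt_trichotomy i j with h1 | h1 | h1
  · rw [h.adj_iff i j h1 hj]; omega
  · subst h1; simp
  · rw [G.adj_comm, h.adj_iff j i h1 hi]; omega

lemma IsInducedPath.reverse {g : ℕ → V} {s : ℕ} (h : G.IsInducedPath g s) :
    G.IsInducedPath (fun i => g (s - i)) s where
  ne i j hij hj := fun he => by have := h.inj (by omega) (by omega) he; omega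
  adj_iff i j hij hj := by rw [h.adj_iff' (by omega) (by omega)]; omega

/-- A shortest walk inside a set is an induced path. -/
lemma exists_isInducedPath_of_walk {X : Set V} {a b : V} (p : G.Walk a b)
    (hp : ∀ v ∈ p.support, v ∈ X) :
    ∃ (g : ℕ → V) (s : ℕ), G.IsInducedPath g s ∧ g 0 = a ∧ g s = b ∧ ∀ i ≤ s, g i ∈ X := by
  classical
  have hex : ∃ n, ∃ q : G.Walk a b, q.length = n ∧ ∀ v ∈ q.support, v ∈ X := ⟨_, p, rfl, hp⟩
  obtain ⟨q, hql, hqX⟩ := Nat.find_spec hex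
  have hmin : ∀ q' : G.Walk a b, (∀ v ∈ q'.support, v ∈ X) → q.length ≤ q'.length := by
    intro q' hq'
    rw [hql]
    exact Nat.find_min' hex ⟨q', rfl, hq'⟩
  have hsub : ∀ i, ∀ v ∈ (q.take i).support, v ∈ X := fun i v hv =>
    hqX v ((Walk.isSubwalk_take q i).support_subset hv)
  have hsub' : ∀ i, ∀ v ∈ (q.drop i).support, v ∈ X := fun i v hv =>
    hqX v ((Walk.isSubwalk_drop q i).support_subset hv)
  -- A repeated vertex, like a chord further down, would give a shortcut within `X`.
  have hne : ∀ i j, i < j → j ≤ q.length → q.getVert i ≠ q.getVert j := by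
    intro i j hij hj he
    have := hmin ((q.take i).append ((q.drop j).copy he.symm rfl)) (by
      intro v hv
      rw [Walk.mem_support_append_iff, Walk.support_copy] at hv
      exact hv.elim (hsub _ _) (hsub' _ _))
    simp [Walk.take_length, Walk.drop_length] at this
    omega
  refine ⟨q.getVert, q.length, ⟨hne, ?_⟩, by simp, by simp, fun i _ =>
    hqX _ (q.getVert_mem_support i)⟩
  intro i j hij hj
  constructor
  · intro hadj
    have := hmin ((q.take i).append (Walk.cons hadj (q.drop j))) (by
      intro v hv
      rw [Walk.mem_support_append_iff, Walk.support_cons, List.mem_cons] at hv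
      rcases hv with hv | rfl | hv
      · exact hsub _ _ hv
      · exact hqX _ (q.getVert_mem_support i)
      · exact hsub' _ _ hv)
    simp [Walk.take_length, Walk.drop_length] at this
    omega
  · rintro rfl
    exact q.adj_getVert_succ (by omega)

end Basics

end SimpleGraph

/-! ### Subdivisions of `K₄` and their relation to `K₄`-minors. -/

namespace SimpleGraph

section Model

variable {V : Type*} {G : SimpleGraph V}

/-- A subgraph of `G` that is a subdivision of `K₄`. -/
structure K4Model (G : SimpleGraph V) where
  branch : Fin 4 → V
  branch_inj : Function.Injective branch
  path : ∀ a b : Fin 4, a ≠ b → G.Walk (branch a) (branch b)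
  isPath : ∀ (a b : Fin 4) (h : a ≠ b), (path a b h).IsPath
  path_symm : ∀ (a b : Fin 4) (h : a ≠ b), path b a h.symm = (path a b h).reverse
  branch_mem : ∀ (a b c : Fin 4) (h : a ≠ b),
    branch c ∈ (path a b h).support → c = a ∨ c = b
  disjoint : ∀ (a b c d : Fin 4) (h : a ≠ b) (h' : c ≠ d), s(a, b) ≠ s(c, d) →
    ∀ x, x ∈ (path a b h).support → x ∈ (path c d h').support → ∃ w, branch w = x

namespace K4Model

variable (T : K4Model G)

/-- The `k`-th vertex of the path from the branch vertex `a` to the branch vertex `b`. -/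
def pt (a b : Fin 4) (k : ℕ) : V := if h : a ≠ b then (T.path a b h).getVert k else T.branch a

/-- The length of the path from the branch vertex `a` to the branch vertex `b`. -/
def len (a b : Fin 4) : ℕ := if h : a ≠ b then (T.path a b h).length else 0

/-- The vertices of the subdivision. -/
def verts : Set V := {v | ∃ a b k, a ≠ b ∧ k ≤ T.len a b ∧ T.pt a b k = v}

variable {T}

lemma pt_zero (a b : Fin 4) : T.pt a b 0 = T.branch a := by
  unfold pt; split_ifs <;> simp

lemma pt_len {a b : Fin 4} (h : a ≠ b) : T.pt a b (T.len a b) = T.branch b := by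
  simp [pt, len, h]

lemma len_comm (a b : Fin 4) : T.len b a = T.len a b := by
  by_cases h : a = b
  · rw [h]
  · rw [len, len, dif_pos h, dif_pos (Ne.symm h), T.path_symm a b h, Walk.length_reverse]

lemma pt_comm {a b : Fin 4} (h : a ≠ b) (k : ℕ) : T.pt b a k = T.pt a b (T.len a b - k) := by
  rw [pt, pt, len, dif_pos h, dif_pos h, dif_pos h.symm, T.path_symm a b h, Walk.getVert_reverse]

lemma len_pos {a b : Fin 4} (h : a ≠ b) : 0 < T.len a b := by
  rcases Nat.eq_zero_or_pos (T.len a b) with h0 | h0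
  · have := pt_len (T := T) h
    rw [h0, pt_zero] at this
    exact absurd (T.branch_inj this) h
  · exact h0

lemma adj_pt {a b : Fin 4} (h : a ≠ b) {k : ℕ} (hk : k < T.len a b) :
    G.Adj (T.pt a b k) (T.pt a b (k + 1)) := by
  simp only [pt, len, dif_pos h] at hk ⊢
  exact Walk.adj_getVert_succ _ hk

lemma pt_inj {a b : Fin 4} (h : a ≠ b) {k k' : ℕ} (hk : k ≤ T.len a b) (hk' : k' ≤ T.len a b)
    (he : T.pt a b k = T.pt a b k') : k = k' := by
  simp only [pt, len, dif_pos h] at hk hk' he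
  exact (T.isPath a b h).getVert_injOn hk hk' he

lemma pt_mem_support {a b : Fin 4} (h : a ≠ b) (k : ℕ) :
    T.pt a b k ∈ (T.path a b h).support := by
  simp only [pt, dif_pos h]
  exact Walk.getVert_mem_support _ _

lemma pt_ne_branch {a b : Fin 4} (h : a ≠ b) {k : ℕ} (hk : 0 < k) (hk' : k < T.len a b)
    (c : Fin 4) : T.pt a b k ≠ T.branch c := by
  intro he
  rcases T.branch_mem a b c h (he ▸ pt_mem_support h k) with rfl | rfl
  · rw [← pt_zero c b] at he
    have := pt_inj h hk'.le (by omega) he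
    omega
  · rw [← pt_len h] at he
    have := pt_inj h hk'.le le_rfl he
    omega

/-- An interior vertex determines its path up to orientation; the two cases are the two
orientations. -/
lemma eq_of_pt_eq_pt {a b c d : Fin 4} (h : a ≠ b) (h' : c ≠ d) {k k' : ℕ} (hk : 0 < k)
    (hkl : k < T.len a b) (hk' : k' ≤ T.len c d) (he : T.pt a b k = T.pt c d k') :
    (c = a ∧ d = b ∧ k' = k) ∨ (c = b ∧ d = a ∧ k' + k = T.len a b) := by
  by_cases hs : s(a, b) = s(c, d)
  · rcases Sym2.eq_iff.mp hs with ⟨rfl, rfl⟩ | ⟨rfl, rfl⟩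
    · exact Or.inl ⟨rfl, rfl, (pt_inj h hkl.le hk' he).symm⟩
    · rw [pt_comm h] at he
      rw [len_comm] at hk'
      have := pt_inj h hkl.le (by omega) he
      exact Or.inr ⟨rfl, rfl, by omega⟩
  · obtain ⟨w, hw⟩ := T.disjoint a b c d h h' hs _ (pt_mem_support h k)
      (he ▸ pt_mem_support h' k')
    exact absurd hw.symm (pt_ne_branch h hk hkl w)

lemma branch_eq_pt {a c d : Fin 4} (h : c ≠ d) {k : ℕ} (hk : k ≤ T.len c d)
    (he : T.branch a = T.pt c d k) : (c = a ∧ k = 0) ∨ (d = a ∧ k = T.len c d) := by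
  rcases Nat.eq_zero_or_pos k with rfl | h0
  · rw [pt_zero] at he
    exact Or.inl ⟨(T.branch_inj he).symm, rfl⟩
  · rcases hk.lt_or_eq with h1 | rfl
    · exact absurd he.symm (pt_ne_branch h h0 h1 a)
    · rw [pt_len h] at he
      exact Or.inr ⟨(T.branch_inj he).symm, rfl⟩

lemma branch_mem_verts (a : Fin 4) : T.branch a ∈ T.verts := by
  obtain ⟨b, hb⟩ : ∃ b, a ≠ b := ⟨a + 1, by revert a; decide⟩
  exact ⟨a, b, 0, hb, Nat.zero_le _, pt_zero a b⟩

lemma mem_verts_of_mem_support {a b : Fin 4} (h : a ≠ b) {x : V}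
    (hx : x ∈ (T.path a b h).support) : x ∈ T.verts := by
  obtain ⟨n, hn, hl⟩ := Walk.mem_support_iff_exists_getVert.mp hx
  exact ⟨a, b, n, h, by simp [len, h, hl], by simp [pt, h, hn]⟩

lemma verts_cases {x : V} (hx : x ∈ T.verts) : (∃ a, x = T.branch a) ∨
    ∃ a b k, a ≠ b ∧ 0 < k ∧ k < T.len a b ∧ x = T.pt a b k := by
  obtain ⟨a, b, k, hab, hk, rfl⟩ := hx
  rcases Nat.eq_zero_or_pos k with rfl | h0
  · exact Or.inl ⟨a, pt_zero a b⟩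
  · rcases hk.lt_or_eq with h1 | rfl
    · exact Or.inr ⟨a, b, k, hab, h0, h1, rfl⟩
    · exact Or.inl ⟨b, pt_len hab⟩

variable (T) in
/-- The vertices at distance less than `t a b` from the branch vertex `a` on the path to `b`,
for some `b`. -/
def ball (t : Fin 4 → Fin 4 → ℕ) (a : Fin 4) : Set V :=
  {v | ∃ b, a ≠ b ∧ ∃ k < t a b, T.pt a b k = v}

variable (T) in
/-- Cut numbers: `t a b` vertices of the path from `a` to `b` are assigned to `a`. -/
def IsCut (t : Fin 4 → Fin 4 → ℕ) : Prop :=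
  ∀ a b, a ≠ b → 1 ≤ t a b ∧ t a b + t b a ≤ T.len a b + 1

lemma IsCut.le {t : Fin 4 → Fin 4 → ℕ} (ht : T.IsCut t) {a b : Fin 4} (h : a ≠ b) :
    t a b ≤ T.len a b := by
  have := ht a b h
  have := ht b a h.symm
  omega

lemma IsCut.pt_mem_ball {t : Fin 4 → Fin 4 → ℕ} {a b : Fin 4} (h : a ≠ b)
    {k : ℕ} (hk : k < t a b) : T.pt a b k ∈ T.ball t a := ⟨b, h, k, hk, rfl⟩

lemma IsCut.pt_mem_ball' {t : Fin 4 → Fin 4 → ℕ} {a b : Fin 4} (h : a ≠ b)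
    {k : ℕ} (hk : T.len a b < k + t b a) (hk' : k ≤ T.len a b) : T.pt a b k ∈ T.ball t b :=
  ⟨a, h.symm, T.len a b - k, by omega, by
    rw [pt_comm h, Nat.sub_sub_self hk']⟩

lemma IsCut.branch_mem_ball {t : Fin 4 → Fin 4 → ℕ} (ht : T.IsCut t) (a : Fin 4) :
    T.branch a ∈ T.ball t a := by
  obtain ⟨b, hb⟩ : ∃ b, a ≠ b := ⟨a + 1, by revert a; decide⟩
  exact ⟨b, hb, 0, (ht a b hb).1, pt_zero a b⟩

lemma IsCut.ball_subset {t : Fin 4 → Fin 4 → ℕ} (ht : T.IsCut t) (a : Fin 4) :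
    T.ball t a ⊆ T.verts := by
  rintro v ⟨b, hb, k, hk, rfl⟩
  exact ⟨a, b, k, hb, by have := ht.le hb; omega, rfl⟩

lemma IsCut.connected_ball {t : Fin 4 → Fin 4 → ℕ} (ht : T.IsCut t) (a : Fin 4) :
    (G.induce (T.ball t a)).Connected := by
  refine induce_connected_of_patches (T.branch a) (ht.branch_mem_ball a) ?_
  rintro v ⟨b, hb, k, hk, rfl⟩
  have hc : (G.induce (arc (T.pt a b) 0 (t a b))).Connected := by
    refine connected_induce_arc (by omega) fun k _ hk => adj_pt hb ?_
    have := ht.le hb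
    omega
  refine ⟨arc (T.pt a b) 0 (t a b), ?_, ⟨0, le_rfl, by omega, pt_zero a b⟩,
    mem_arc (Nat.zero_le _) hk, hc.preconnected _ _⟩
  rintro _ ⟨k, -, hk, rfl⟩
  exact ⟨b, hb, k, hk, rfl⟩

lemma IsCut.eq_of_pt_mem_ball {t : Fin 4 → Fin 4 → ℕ} (ht : T.IsCut t) {a b c : Fin 4}
    (h : a ≠ b) {k : ℕ} (hk : 0 < k) (hk' : k < T.len a b) (hc : T.pt a b k ∈ T.ball t c) :
    (c = a ∧ k < t a b) ∨ (c = b ∧ T.len a b < k + t b a) := by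
  obtain ⟨d, hd, k', hk1, he⟩ := hc
  have := ht.le hd
  rcases eq_of_pt_eq_pt h hd hk hk' (by omega) he.symm with ⟨rfl, rfl, rfl⟩ | ⟨rfl, rfl, h3⟩
  · exact Or.inl ⟨rfl, hk1⟩
  · exact Or.inr ⟨rfl, by omega⟩

lemma IsCut.eq_of_branch_mem_ball {t : Fin 4 → Fin 4 → ℕ} (ht : T.IsCut t) {a c : Fin 4}
    (hc : T.branch a ∈ T.ball t c) : c = a := by
  obtain ⟨d, hd, k', hk1, he⟩ := hc
  have h1 := ht.le hd
  have h2 := ht d c hd.symm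
  have h3 := ht c d hd
  rcases branch_eq_pt hd (by omega) he.symm with ⟨rfl, rfl⟩ | ⟨rfl, rfl⟩
  · rfl
  · omega

lemma IsCut.disjoint_ball {t : Fin 4 → Fin 4 → ℕ} (ht : T.IsCut t) {a c : Fin 4} (hac : a ≠ c)
    (v : V) (hv : v ∈ T.ball t a) : v ∉ T.ball t c := by
  intro hv'
  rcases verts_cases (ht.ball_subset a hv) with ⟨d, rfl⟩ | ⟨d, e, k, hde, hk, hk', rfl⟩
  · exact hac ((ht.eq_of_branch_mem_ball hv).trans (ht.eq_of_branch_mem_ball hv').symm)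
  · have := ht d e hde
    rcases ht.eq_of_pt_mem_ball hde hk hk' hv with ⟨rfl, h1⟩ | ⟨rfl, h1⟩ <;>
    rcases ht.eq_of_pt_mem_ball hde hk hk' hv' with ⟨rfl, h2⟩ | ⟨rfl, h2⟩
    · exact hac rfl
    · omega
    · omega
    · exact hac rfl

/-- The path has `len + 1` vertices. If the two parts use all of them, the last vertex of one part
and the first of the other are consecutive. -/
lemma IsCut.adj_ball {t : Fin 4 → Fin 4 → ℕ} (ht : T.IsCut t) {a b : Fin 4} (h : a ≠ b)
    (hab : t a b + t b a = T.len a b + 1) : ∃ x ∈ T.ball t a, ∃ y ∈ T.ball t b, G.Adj x y := by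
  have h1 := ht a b h
  have h2 := ht.le h
  have h3 := (ht b a h.symm).1
  refine ⟨T.pt a b (t a b - 1), IsCut.pt_mem_ball h (by omega), T.pt a b (t a b),
    IsCut.pt_mem_ball' h (by omega) h2, ?_⟩
  have := adj_pt (T := T) h (k := t a b - 1) (by omega)
  rwa [Nat.sub_add_cancel h1.1] at this

/-- Cut numbers for which all pairs of parts are joined yield a `K₄`-minor. -/
lemma IsCut.hasK4Minor {t : Fin 4 → Fin 4 → ℕ} (ht : T.IsCut t)
    (hadj : ∀ a b, a ≠ b → t a b + t b a = T.len a b + 1 ∨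
      ∃ x ∈ T.ball t a, ∃ y ∈ T.ball t b, G.Adj x y) : G.HasK4Minor (⋃ a, T.ball t a) :=
  ⟨T.ball t, fun i => Set.subset_iUnion _ i, ht.connected_ball,
    fun _ _ hij => ht.disjoint_ball hij, fun a b hab =>
      (hadj a b hab).elim (ht.adj_ball hab) id⟩

/-- If a minimal set with a `K₄`-minor is spanned by a subdivision of `K₄`, then cut numbers
for which all pairs of parts are joined leave out no vertex. -/
lemma IsCut.false_of_deficient {t : Fin 4 → Fin 4 → ℕ} (ht : T.IsCut t)
    (hmin : ∀ S, S ⊂ T.verts → ¬ G.HasK4Minor S)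
    (hadj : ∀ a b, a ≠ b → t a b + t b a = T.len a b + 1 ∨
      ∃ x ∈ T.ball t a, ∃ y ∈ T.ball t b, G.Adj x y)
    {a b : Fin 4} (h : a ≠ b) (hd : t a b + t b a ≤ T.len a b) : False := by
  refine hmin _ ⟨Set.iUnion_subset ht.ball_subset, fun hsub => ?_⟩ (ht.hasK4Minor hadj)
  have h1 := (ht a b h).1
  have h2 := (ht b a h.symm).1
  -- The first vertex of the path beyond the part of `a` is missed by both parts.
  obtain ⟨c, hc⟩ := Set.mem_iUnion.mp (hsub ⟨a, b, t a b, h, ht.le h, rfl⟩)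
  rcases ht.eq_of_pt_mem_ball h (by omega) (by omega) hc with ⟨rfl, h3⟩ | ⟨rfl, h3⟩ <;> omega

lemma hasK4Minor_verts (T : K4Model G) : G.HasK4Minor T.verts := by
  -- On each path the end with the smaller index keeps only itself, and the other end takes the
  -- rest.
  have ht : T.IsCut (fun a b => if a < b then 1 else T.len a b) := by
    intro a b h
    have h1 := len_pos (T := T) h
    have h2 := len_comm (T := T) a b
    dsimp only
    split_ifs <;> omega
  refine (ht.hasK4Minor fun a b h => Or.inl ?_).mono (Set.iUnion_subset ht.ball_subset)
  have h2 := len_comm (T := T) a b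
  split_ifs <;> omega

end K4Model

/-- Take a path `P` from `x` to `y` and a path `Q` from `z`; the center is the first vertex of `Q`
on `P`. Legs may be trivial. -/
lemma exists_tripod {B : Set V} (hB : (G.induce B).Connected) {x y z : V} (hx : x ∈ B)
    (hy : y ∈ B) (hz : z ∈ B) : ∃ (c : V) (p : G.Walk c x) (q : G.Walk c y) (r : G.Walk c z),
      p.IsPath ∧ q.IsPath ∧ r.IsPath ∧ (∀ v ∈ p.support, v ∈ B) ∧ (∀ v ∈ q.support, v ∈ B) ∧
      (∀ v ∈ r.support, v ∈ B) ∧ (∀ v ∈ p.support, v ∈ q.support → v = c) ∧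
      (∀ v ∈ p.support, v ∈ r.support → v = c) ∧ (∀ v ∈ q.support, v ∈ r.support → v = c) := by
  classical
  obtain ⟨P, hP, hPB⟩ := exists_walk_of_connected_induce hB hx hy
  obtain ⟨Q, hQ, hQB⟩ := exists_walk_of_connected_induce hB hz hx
  have hex : ∃ n, Q.getVert n ∈ P.support := ⟨Q.length, by simp⟩
  obtain ⟨m, hm, hml⟩ := Walk.mem_support_iff_exists_getVert.mp (Nat.find_spec hex)
  have hmin : ∀ i, Q.getVert i ∈ P.support → Nat.find hex ≤ i := fun i => Nat.find_min' hex
  generalize Nat.find hex = n at hm hmin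
  have hQ' : ∀ v ∈ ((Q.take n).copy rfl hm.symm).reverse.support, v ∈ P.support →
      v = P.getVert m := by
    intro v hv hvP
    rw [Walk.support_reverse, List.mem_reverse, Walk.support_copy] at hv
    obtain ⟨i, hi, hil⟩ := Walk.mem_support_iff_exists_getVert.mp hv
    rw [Walk.take_getVert] at hi
    have := hmin (min n i) (by rw [hi]; exact hvP)
    rw [← hi, show min n i = n by omega, hm]
  refine ⟨P.getVert m, (P.take m).reverse, P.drop m, ((Q.take n).copy rfl hm.symm).reverse,
    (hP.take m).reverse, hP.drop m, ?_, ?_, ?_, ?_, ?_, ?_, ?_⟩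
  · rw [Walk.isPath_reverse_iff, Walk.isPath_copy]
    exact hQ.take n
  · intro v hv
    rw [Walk.support_reverse, List.mem_reverse] at hv
    exact hPB v ((Walk.isSubwalk_take P m).support_subset hv)
  · intro v hv
    exact hPB v ((Walk.isSubwalk_drop P m).support_subset hv)
  · intro v hv
    rw [Walk.support_reverse, List.mem_reverse, Walk.support_copy] at hv
    exact hQB v ((Walk.isSubwalk_take Q n).support_subset hv)
  · intro v hv hv'
    rw [Walk.support_reverse, List.mem_reverse] at hv
    obtain ⟨i, hi, hil⟩ := Walk.mem_support_iff_exists_getVert.mp hv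
    obtain ⟨j, hj, hjl⟩ := Walk.mem_support_iff_exists_getVert.mp hv'
    rw [Walk.take_getVert] at hi
    rw [Walk.drop_getVert] at hj
    rw [Walk.drop_length] at hjl
    have := hP.getVert_injOn (by simp; omega) (by simp; omega) (hi.trans hj.symm)
    rw [← hi]
    congr 1
    omega
  · intro v hv hv'
    rw [Walk.support_reverse, List.mem_reverse] at hv
    exact hQ' v hv' ((Walk.isSubwalk_take P m).support_subset hv)
  · intro v hv hv'
    exact hQ' v hv' ((Walk.isSubwalk_drop P m).support_subset hv)

/-- The tripod inside one branch set of a `K₄`-minor, with its legs indexed by the three other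
branch sets. -/
lemma exists_legs {B : Set V} (hB : (G.induce B).Connected) (i : Fin 4) (a : Fin 4 → V)
    (ha : ∀ j, j ≠ i → a j ∈ B) : ∃ (c : V) (q : ∀ j, j ≠ i → G.Walk c (a j)),
      (∀ j h, (q j h).IsPath) ∧ (∀ j h, ∀ v ∈ (q j h).support, v ∈ B) ∧
      ∀ j h k h', j ≠ k → ∀ v ∈ (q j h).support, v ∈ (q k h').support → v = c := by
  have key : ∀ j k l : Fin 4, j ≠ i → k ≠ i → l ≠ i → j ≠ k → j ≠ l → k ≠ l →
      (∀ o, o ≠ i → o = j ∨ o = k ∨ o = l) → ∃ (c : V) (q : ∀ j, j ≠ i → G.Walk c (a j)),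
      (∀ j h, (q j h).IsPath) ∧ (∀ j h, ∀ v ∈ (q j h).support, v ∈ B) ∧
      ∀ j h k h', j ≠ k → ∀ v ∈ (q j h).support, v ∈ (q k h').support → v = c := by
    intro j k l hj hk hl hjk hjl hkl hall
    obtain ⟨c, p, q, r, hp, hq, hr, hpB, hqB, hrB, hpq, hpr, hqr⟩ :=
      exists_tripod hB (ha j hj) (ha k hk) (ha l hl)
    -- The type of a leg depends on its index, so each leg is pinned down up to `Walk.copy` before
    -- being chosen.
    have hw : ∀ o, o ≠ i → ∃ w : G.Walk c (a o), (∀ h : o = j, w = p.copy rfl (by rw [h])) ∧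
        (∀ h : o = k, w = q.copy rfl (by rw [h])) ∧
        (∀ h : o = l, w = r.copy rfl (by rw [h])) := by
      intro o ho
      rcases hall o ho with rfl | rfl | rfl
      · exact ⟨p, fun _ => rfl, fun h => absurd h hjk, fun h => absurd h hjl⟩
      · exact ⟨q, fun h => absurd h.symm hjk, fun _ => rfl, fun h => absurd h hkl⟩
      · exact ⟨r, fun h => absurd h.symm hjl, fun h => absurd h.symm hkl, fun _ => rfl⟩
    choose w hw1 hw2 hw3 using hw
    have e1 : w j hj = p := hw1 j hj rfl
    have e2 : w k hk = q := hw2 k hk rfl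
    have e3 : w l hl = r := hw3 l hl rfl
    refine ⟨c, w, ?_, ?_, ?_⟩
    · intro o ho
      rcases hall o ho with rfl | rfl | rfl <;> simp_all
    · intro o ho
      rcases hall o ho with rfl | rfl | rfl <;> simp_all
    · intro o ho o' ho' hoo v hv hv'
      rcases hall o ho with rfl | rfl | rfl <;> rcases hall o' ho' with rfl | rfl | rfl <;>
        first
          | exact absurd rfl hoo
          | (rw [e1] at hv; rw [e2] at hv'; exact hpq v hv hv')
          | (rw [e1] at hv; rw [e3] at hv'; exact hpr v hv hv')
          | (rw [e2] at hv; rw [e3] at hv'; exact hqr v hv hv')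
          | (rw [e2] at hv; rw [e1] at hv'; exact hpq v hv' hv)
          | (rw [e3] at hv; rw [e1] at hv'; exact hpr v hv' hv)
          | (rw [e3] at hv; rw [e2] at hv'; exact hqr v hv' hv)
  refine key (i + 1) (i + 2) (i + 3) ?_ ?_ ?_ ?_ ?_ ?_ ?_ <;> clear key ha <;> revert i <;> decide

/-- A `K₄`-minor contains a subdivision of `K₄`. -/
lemma HasK4Minor.exists_model {S : Set V} (hS : G.HasK4Minor S) :
    ∃ T : K4Model G, T.verts ⊆ S := by
  classical
  obtain ⟨B, hBS, hBc, hBd, hBa⟩ := hS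
  have hp : ∀ i j, ∃ p : V × V, i ≠ j → p.1 ∈ B i ∧ p.2 ∈ B j ∧ G.Adj p.1 p.2 := by
    intro i j
    by_cases h : i = j
    · obtain ⟨x, hx, -⟩ := hBa 0 1 (by decide)
      exact ⟨(x, x), fun h' => absurd h h'⟩
    · obtain ⟨x, hx, y, hy, hxy⟩ := hBa i j h
      exact ⟨(x, y), fun _ => ⟨hx, hy, hxy⟩⟩
  choose p hp using hp
  obtain ⟨a, haB, haa⟩ : ∃ a : Fin 4 → Fin 4 → V, (∀ i j, j ≠ i → a i j ∈ B i) ∧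
      ∀ i j, i ≠ j → G.Adj (a i j) (a j i) := by
    -- One edge per unordered pair, as the paths must not depend on the orientation.
    refine ⟨fun i j => if i < j then (p i j).1 else (p j i).2, ?_, ?_⟩
    · intro i j h
      dsimp only
      split_ifs
      · exact (hp i j h.symm).1
      · exact (hp j i h).2.1
    · intro i j h
      dsimp only
      rcases lt_or_gt_of_ne h with h1 | h1
      · rw [if_pos h1, if_neg (by omega)]
        exact (hp i j h).2.2
      · rw [if_pos h1, if_neg (by omega)]
        exact (hp j i h.symm).2.2.symm
  choose c q hqp hqB hqd using fun i => exists_legs (hBc i) i (a i) (haB i)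
  have hcB : ∀ i, c i ∈ B i := by
    intro i
    obtain ⟨j, hj⟩ : ∃ j, j ≠ i := ⟨i + 1, by revert i; decide⟩
    exact hqB i j hj _ (Walk.start_mem_support _)
  have hBi : ∀ {i j v}, v ∈ B i → v ∈ B j → i = j := by
    intro i j v hi hj
    by_contra h
    exact hBd i j h v hi hj
  let P : ∀ i j, i ≠ j → G.Walk (c i) (c j) := fun i j h =>
    (q i j h.symm).append (Walk.cons (haa i j h) (q j i h).reverse)
  have hsupp : ∀ i j h v, v ∈ (P i j h).support →
      v ∈ (q i j h.symm).support ∨ v ∈ (q j i h).support := by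
    intro i j h v hv
    simp only [P, Walk.mem_support_append_iff, Walk.support_cons, List.mem_cons,
      Walk.support_reverse, List.mem_reverse] at hv
    rcases hv with hv | rfl | hv
    · exact Or.inl hv
    · exact Or.inl (Walk.end_mem_support _)
    · exact Or.inr hv
  refine ⟨⟨c, ?_, P, ?_, ?_, ?_, ?_⟩, ?_⟩
  · intro i j h
    exact hBi (hcB i) (h ▸ hcB j)
  · intro i j h
    rw [Walk.isPath_def, Walk.support_append, Walk.support_cons, List.tail_cons,
      Walk.support_reverse, List.nodup_append]
    refine ⟨(hqp i j h.symm).support_nodup, List.nodup_reverse.mpr (hqp j i h).support_nodup, ?_⟩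
    rintro x hx y hy rfl
    exact h (hBi (hqB i j h.symm x hx) (hqB j i h x (List.mem_reverse.mp hy)))
  · intro i j h
    simp only [P, Walk.reverse_append, Walk.reverse_cons, Walk.reverse_reverse, ← Walk.append_assoc,
      Walk.cons_append, Walk.nil_append]
  · intro i j k h hk
    rcases hsupp i j h _ hk with h1 | h1
    · exact Or.inl (hBi (hcB k) (hqB _ _ _ _ h1))
    · exact Or.inr (hBi (hcB k) (hqB _ _ _ _ h1))
  · intro i j k l h h' hne x hx hx'
    have main : ∀ {i j k l : Fin 4} (h : j ≠ i) (h' : l ≠ k), s(i, j) ≠ s(k, l) →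
        x ∈ (q i j h).support → x ∈ (q k l h').support → ∃ w, c w = x := by
      intro i j k l h h' hne h1 h2
      -- A common vertex lies in a single branch set, hence on two different legs there, which meet
      -- only in the center.
      obtain rfl := hBi (hqB _ _ _ _ h1) (hqB _ _ _ _ h2)
      exact ⟨i, (hqd i j h l h' (by rintro rfl; exact hne rfl) x h1 h2).symm⟩
    rcases hsupp i j h _ hx with h1 | h1 <;> rcases hsupp k l h' _ hx' with h2 | h2
    · exact main h.symm h'.symm hne h1 h2
    · exact main h.symm h' (by rwa [Sym2.eq_swap (a := l)]) h1 h2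
    · exact main h h'.symm (by rwa [Sym2.eq_swap (a := j)]) h1 h2
    · exact main h h' (by rwa [Sym2.eq_swap (a := j), Sym2.eq_swap (a := l)]) h1 h2
  · rintro v ⟨i, j, k, hij, hk, rfl⟩
    refine (hsupp i j hij _ ?_).elim (fun h1 => hBS i (hqB _ _ _ _ h1))
      fun h1 => hBS j (hqB _ _ _ _ h1)
    exact K4Model.pt_mem_support hij k

/-- A subgraph that is a subdivision of `K₄` yields a model. -/
lemma exists_model_of_not_isSeriesParallel (h : ¬ G.IsSeriesParallel) : Nonempty (K4Model G) := by
  simp only [IsSeriesParallel, not_forall, not_not] at h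
  obtain ⟨H, ⟨M⟩⟩ := h
  have hinj : Function.Injective H.hom := Subgraph.hom_injective
  refine ⟨⟨fun i => H.hom (M.branch i), hinj.comp M.branch.injective,
    fun a b h => (M.path a b h).map H.hom, ?_, ?_, ?_, ?_⟩⟩
  · intro a b h
    exact (M.isPath a b h).map hinj
  · intro a b h
    exact (congrArg (Walk.map H.hom) (M.path_symm a b h)).trans (Walk.reverse_map _ _).symm
  · intro a b c h hc
    rw [Walk.support_map] at hc
    obtain ⟨v, hv, he⟩ := List.mem_map.mp hc
    rw [hinj he] at hv
    exact M.branch_mem a b c h hv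
  · intro a b c d h h' hne x hx hx'
    rw [Walk.support_map] at hx hx'
    obtain ⟨v, hv, rfl⟩ := List.mem_map.mp hx
    obtain ⟨v', hv', he⟩ := List.mem_map.mp hx'
    rw [hinj he] at hv'
    obtain ⟨w, hw⟩ := M.disjoint a b c d h h' hne v hv hv'
    exact ⟨w, by rw [hw]⟩

end Model

end SimpleGraph

/-! ### Chords of a minimal subdivision of `K₄`. -/

namespace SimpleGraph

section Chords

variable {V : Type*} {G : SimpleGraph V}

/-- The vertices `h 0, …, h (m - 1)` are distinct and induce a cycle, in this order. -/
structure IsHole (G : SimpleGraph V) (h : ℕ → V) (m : ℕ) : Prop where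
  four_le : 4 ≤ m
  ne : ∀ i j, i < j → j < m → h i ≠ h j
  adj_iff : ∀ i j, i < j → j < m → (G.Adj (h i) (h j) ↔ j = i + 1 ∨ (i = 0 ∧ j + 1 = m))

namespace K4Model

variable {T : K4Model G}

/-- Otherwise the chord bypasses the vertices between its ends, and these can be left out. -/
lemma eq_succ_of_adj_same (hmin : ∀ S, S ⊂ T.verts → ¬ G.HasK4Minor S) {a b : Fin 4}
    (h : a ≠ b) {k k' : ℕ} (hk : k < k') (hk' : k' ≤ T.len a b)
    (hadj : G.Adj (T.pt a b k) (T.pt a b k')) : k' = k + 1 := by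
  by_contra hne
  -- The default values `1` and `T.len c d` divide the remaining paths completely; the same pattern
  -- recurs below.
  set t : Fin 4 → Fin 4 → ℕ := fun c d => if c = a ∧ d = b then k + 1 else
    if c = b ∧ d = a then T.len a b - k' + 1 else if c < d then 1 else T.len c d with htdef
  have hlc := len_comm (T := T)
  have hlp := @len_pos _ _ T
  have tab : t a b = k + 1 := by simp [htdef]
  have tba : t b a = T.len a b - k' + 1 := by simp [htdef, h.symm]
  have ht : T.IsCut t := by
    intro c d hcd
    have h1 := hlp hcd
    have h2 := hlc c d
    grind
  refine ht.false_of_deficient hmin (fun c d hcd => ?_) h (by omega)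
  have h1 := hlp hcd
  have h2 := hlc c d
  have m1 : T.pt a b k ∈ T.ball t a := IsCut.pt_mem_ball h (by omega)
  have m2 : T.pt a b k' ∈ T.ball t b := IsCut.pt_mem_ball' h (by omega) hk'
  by_cases hc1 : c = a ∧ d = b
  · obtain ⟨rfl, rfl⟩ := hc1
    exact Or.inr ⟨_, m1, _, m2, hadj⟩
  by_cases hc2 : c = b ∧ d = a
  · obtain ⟨rfl, rfl⟩ := hc2
    exact Or.inr ⟨_, m2, _, m1, hadj.symm⟩
  left
  grind

/-- The part of `i` grows along the path to `m` up to the chord, and the part of `j` stops at the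
chord. The vertices of the path from `i` to `j` strictly between `i` and the chord become
superfluous. -/
lemma eq_one_of_adj_adjacent (hmin : ∀ S, S ⊂ T.verts → ¬ G.HasK4Minor S) {i j m : Fin 4}
    (hij : i ≠ j) (him : i ≠ m) (hjm : j ≠ m) {k k' : ℕ} (hk : 0 < k) (hkl : k < T.len i j)
    (_ : 0 < k') (hkl' : k' < T.len i m)
    (hadj : G.Adj (T.pt i j k) (T.pt i m k')) : k = 1 := by
  by_contra hne
  set t : Fin 4 → Fin 4 → ℕ := fun c d => if c = i ∧ d = j then 1 else
    if c = j ∧ d = i then T.len i j - k + 1 else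
    if c = i ∧ d = m then k' + 1 else
    if c = m ∧ d = i then T.len i m - k' else if c < d then 1 else T.len c d with htdef
  have hlc := len_comm (T := T)
  have hlp := @len_pos _ _ T
  have tij : t i j = 1 := by simp [htdef]
  have tji : t j i = T.len i j - k + 1 := by simp [htdef, hij.symm]
  have tim : t i m = k' + 1 := by grind
  have ht : T.IsCut t := by
    intro c d hcd
    have h1 := hlp hcd
    have h2 := hlc c d
    grind
  refine ht.false_of_deficient hmin (fun c d hcd => ?_) hij (by omega)
  have h1 := hlp hcd
  have h2 := hlc c d
  have m1 : T.pt i j k ∈ T.ball t j := IsCut.pt_mem_ball' hij (by omega) hkl.le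
  have m2 : T.pt i m k' ∈ T.ball t i := IsCut.pt_mem_ball him (by omega)
  by_cases hc1 : c = i ∧ d = j
  · obtain ⟨rfl, rfl⟩ := hc1
    exact Or.inr ⟨_, m2, _, m1, hadj.symm⟩
  by_cases hc2 : c = j ∧ d = i
  · obtain ⟨rfl, rfl⟩ := hc2
    exact Or.inr ⟨_, m1, _, m2, hadj⟩
  left
  grind

/-- The parts of `i` and `m` grow up to the ends of the chord, which then replaces the path from `i`
to `m`. -/
lemma len_eq_one_of_adj_opposite (hmin : ∀ S, S ⊂ T.verts → ¬ G.HasK4Minor S) {i j m l : Fin 4}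
    (hij : i ≠ j) (him : i ≠ m) (hil : i ≠ l) (hjm : j ≠ m) (hjl : j ≠ l) (hml : m ≠ l)
    {k k' : ℕ} (_ : 0 < k) (hkl : k < T.len i j) (_ : 0 < k') (hkl' : k' < T.len m l)
    (hadj : G.Adj (T.pt i j k) (T.pt m l k')) : T.len i m = 1 := by
  by_contra hne
  set t : Fin 4 → Fin 4 → ℕ := fun c d => if c = i ∧ d = j then k + 1 else
    if c = j ∧ d = i then T.len i j - k else
    if c = m ∧ d = l then k' + 1 else
    if c = l ∧ d = m then T.len m l - k' else
    if c = i ∧ d = m then 1 else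
    if c = m ∧ d = i then 1 else if c < d then 1 else T.len c d with htdef
  have hlc := len_comm (T := T)
  have hlp := @len_pos _ _ T
  have tij : t i j = k + 1 := by grind
  have tml : t m l = k' + 1 := by grind
  have tim : t i m = 1 := by grind
  have tmi : t m i = 1 := by grind
  have ht : T.IsCut t := by
    intro c d hcd
    have h1 := hlp hcd
    have h2 := hlc c d
    grind (splits := 25)
  have := hlp him
  refine ht.false_of_deficient hmin (fun c d hcd => ?_) him (by omega)
  have h1 := hlp hcd
  have h2 := hlc c d
  have m1 : T.pt i j k ∈ T.ball t i := IsCut.pt_mem_ball hij (by omega)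
  have m2 : T.pt m l k' ∈ T.ball t m := IsCut.pt_mem_ball hml (by omega)
  by_cases hc1 : c = i ∧ d = m
  · obtain ⟨rfl, rfl⟩ := hc1
    exact Or.inr ⟨_, m1, _, m2, hadj⟩
  by_cases hc2 : c = m ∧ d = i
  · obtain ⟨rfl, rfl⟩ := hc2
    exact Or.inr ⟨_, m2, _, m1, hadj.symm⟩
  left
  grind (splits := 25)

/-- The part of `j` grows up to the chord, which then replaces the path from `i` to `j`. -/
lemma len_eq_one_of_branch_adj (hmin : ∀ S, S ⊂ T.verts → ¬ G.HasK4Minor S) {i j m : Fin 4}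
    (hij : i ≠ j) (him : i ≠ m) (hjm : j ≠ m) {k : ℕ} (_ : 0 < k) (hkl : k < T.len j m)
    (hadj : G.Adj (T.branch i) (T.pt j m k)) : T.len i j = 1 := by
  by_contra hne
  set t : Fin 4 → Fin 4 → ℕ := fun c d => if c = j ∧ d = m then k + 1 else
    if c = m ∧ d = j then T.len j m - k else
    if c = i ∧ d = j then 1 else
    if c = j ∧ d = i then 1 else if c < d then 1 else T.len c d with htdef
  have hlc := len_comm (T := T)
  have hlp := @len_pos _ _ T
  have tjm : t j m = k + 1 := by grind
  have tij : t i j = 1 := by grind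
  have tji : t j i = 1 := by grind
  have ht : T.IsCut t := by
    intro c d hcd
    have h1 := hlp hcd
    have h2 := hlc c d
    grind (splits := 25)
  have := hlp hij
  refine ht.false_of_deficient hmin (fun c d hcd => ?_) hij (by omega)
  have h1 := hlp hcd
  have h2 := hlc c d
  have m1 : T.branch i ∈ T.ball t i := ht.branch_mem_ball i
  have m2 : T.pt j m k ∈ T.ball t j := IsCut.pt_mem_ball hjm (by omega)
  by_cases hc1 : c = i ∧ d = j
  · obtain ⟨rfl, rfl⟩ := hc1
    exact Or.inr ⟨_, m1, _, m2, hadj⟩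
  by_cases hc2 : c = j ∧ d = i
  · obtain ⟨rfl, rfl⟩ := hc2
    exact Or.inr ⟨_, m2, _, m1, hadj.symm⟩
  left
  grind (splits := 25)

/-- Another `K₄`-minor is used: the end of the chord on the path from `j` to `m` becomes a branch
set by itself, and the parts of `j` and `l` are merged. It does not need the interior of the path
from `i` to `l`. -/
lemma len_eq_one_of_branch_adj' (hmin : ∀ S, S ⊂ T.verts → ¬ G.HasK4Minor S) {i j m l : Fin 4}
    (hij : i ≠ j) (him : i ≠ m) (hil : i ≠ l) (hjm : j ≠ m) (hjl : j ≠ l) (hml : m ≠ l)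
    {k : ℕ} (hk : 0 < k) (hkl : k < T.len j m)
    (hadj : G.Adj (T.branch i) (T.pt j m k)) : T.len i l = 1 := by
  by_contra hne
  have hlij := len_eq_one_of_branch_adj hmin hij him hjm hk hkl hadj
  have hlim : T.len i m = 1 := by
    refine len_eq_one_of_branch_adj hmin him hij hjm.symm (k := T.len j m - k) (by omega)
      (by have := len_comm (T := T) j m; omega) ?_
    rwa [pt_comm hjm, Nat.sub_sub_self hkl.le]
  -- On the path from `j` to `m` exactly the `k`-th vertex is left unassigned.
  set t : Fin 4 → Fin 4 → ℕ := fun c d => if c = j ∧ d = m then k else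
    if c = m ∧ d = j then T.len j m - k else
    if c = i ∧ d = l then 1 else
    if c = l ∧ d = i then 1 else if c < d then 1 else T.len c d with htdef
  have hlc := len_comm (T := T)
  have hlp := @len_pos _ _ T
  have tjm : t j m = k := by grind
  have tmj : t m j = T.len j m - k := by grind
  have til : t i l = 1 := by grind
  have tli : t l i = 1 := by grind
  have ht : T.IsCut t := by
    intro c d hcd
    have h1 := hlp hcd
    have h2 := hlc c d
    grind (splits := 25)
  have hfull : ∀ c d, c ≠ d → ¬ (c = j ∧ d = m) → ¬ (c = m ∧ d = j) → ¬ (c = i ∧ d = l) →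
      ¬ (c = l ∧ d = i) → t c d + t d c = T.len c d + 1 := by
    intro c d hcd
    have h1 := hlp hcd
    have h2 := hlc c d
    grind (splits := 25)
  have hy : ∀ c, T.pt j m k ∉ T.ball t c := by
    intro c hc
    rcases ht.eq_of_pt_mem_ball hjm hk hkl hc with ⟨rfl, h1⟩ | ⟨rfl, h1⟩ <;> omega
  have hun : (G.induce (T.ball t j ∪ T.ball t l)).Connected :=
    connected_induce_union_of_adj (ht.connected_ball j) (ht.connected_ball l)
      (ht.adj_ball hjl (hfull j l hjl (by grind) (by grind) (by grind) (by grind)))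
  have hminor := hasK4Minor_of_sets (G := G) (T.ball t i) (T.ball t j ∪ T.ball t l) (T.ball t m)
    {T.pt j m k} (ht.connected_ball i) hun (ht.connected_ball m) (connected_induce_singleton _)
    (by
      rintro v hv (h1 | h1)
      · exact ht.disjoint_ball hij v hv h1
      · exact ht.disjoint_ball hil v hv h1)
    (ht.disjoint_ball him) (by rintro v hv rfl; exact hy _ hv)
    (by
      rintro v (h1 | h1)
      · exact ht.disjoint_ball hjm v h1
      · exact ht.disjoint_ball hml.symm v h1)
    (by rintro v (h1 | h1) rfl <;> exact hy _ h1) (by rintro v hv rfl; exact hy _ hv)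
    (by
      obtain ⟨x, hx, y, hy, hxy⟩ :=
        ht.adj_ball hij (hfull i j hij (by grind) (by grind) (by grind) (by grind))
      exact ⟨x, hx, y, Or.inl hy, hxy⟩)
    (ht.adj_ball him (hfull i m him (by grind) (by grind) (by grind) (by grind)))
    ⟨_, ht.branch_mem_ball i, _, rfl, hadj⟩
    (by
      obtain ⟨x, hx, y, hy, hxy⟩ :=
        ht.adj_ball hml.symm (hfull l m hml.symm (by grind) (by grind) (by grind) (by grind))
      exact ⟨x, Or.inr hx, y, hy, hxy⟩)
    ⟨T.pt j m (k - 1), Or.inl (IsCut.pt_mem_ball hjm (by omega)), _, rfl, by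
      have := adj_pt (T := T) hjm (k := k - 1) (by omega)
      rwa [Nat.sub_add_cancel hk] at this⟩
    ⟨T.pt j m (k + 1), IsCut.pt_mem_ball' hjm (by omega) (by omega), _, rfl,
      (adj_pt hjm hkl).symm⟩
  have := hlp hil
  refine hmin _ ⟨?_, fun hsub => ?_⟩ hminor
  · rintro v (((h1 | h1 | h1) | h1) | rfl)
    · exact ht.ball_subset _ h1
    · exact ht.ball_subset _ h1
    · exact ht.ball_subset _ h1
    · exact ht.ball_subset _ h1
    · exact ⟨j, m, k, hjm, hkl.le, rfl⟩
  · have hmem : ∀ c, T.pt i l 1 ∉ T.ball t c := by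
      intro c hc
      rcases ht.eq_of_pt_mem_ball hil Nat.one_pos (by omega) hc with ⟨rfl, h1⟩ | ⟨rfl, h1⟩ <;>
        omega
    rcases hsub ⟨i, l, 1, hil, by omega, rfl⟩ with ((h1 | h1 | h1) | h1) | h1
    · exact hmem _ h1
    · exact hmem _ h1
    · exact hmem _ h1
    · exact hmem _ h1
    · rcases eq_of_pt_eq_pt hil hjm Nat.one_pos (by omega) hkl.le h1 with
        ⟨h2, -, -⟩ | ⟨-, h2, -⟩
      · exact hij h2.symm
      · exact him h2.symm

lemma adj_branch_of_len_eq_one {a b : Fin 4} (h : a ≠ b) (hl : T.len a b = 1) :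
    G.Adj (T.branch a) (T.branch b) := by
  have := adj_pt (T := T) h (k := 0) (by omega)
  rwa [pt_zero, zero_add, ← hl, pt_len h] at this

variable (T) in
/-- `u` and `w` are consecutive on one of the paths of the subdivision. -/
def IsEdge (u w : V) : Prop :=
  ∃ a b k, a ≠ b ∧ k < T.len a b ∧ u = T.pt a b k ∧ w = T.pt a b (k + 1)

lemma IsEdge.symm {u w : V} (h : T.IsEdge u w) : T.IsEdge w u := by
  obtain ⟨a, b, k, hab, hk, rfl, rfl⟩ := h
  refine ⟨b, a, T.len a b - (k + 1), hab.symm,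
    by have := len_comm (T := T) a b; omega, ?_, ?_⟩
  · rw [pt_comm hab, Nat.sub_sub_self (by omega)]
  · rw [pt_comm hab]
    congr 1
    omega

variable (T) in
/-- `u` is a branch vertex and `w` an interior vertex of a path not ending in `u`. -/
def IsCross (u w : V) : Prop :=
  ∃ i j m k, i ≠ j ∧ i ≠ m ∧ j ≠ m ∧ 0 < k ∧ k < T.len j m ∧ u = T.branch i ∧ w = T.pt j m k

lemma isEdge_of_adj_same (hmin : ∀ S, S ⊂ T.verts → ¬ G.HasK4Minor S) {a b : Fin 4}
    (h : a ≠ b) {k k' : ℕ} (hk : k ≤ T.len a b) (hk' : k' ≤ T.len a b)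
    (hadj : G.Adj (T.pt a b k) (T.pt a b k')) : T.IsEdge (T.pt a b k) (T.pt a b k') := by
  rcases Nat.lt_trichotomy k k' with h1 | rfl | h1
  · obtain rfl := eq_succ_of_adj_same hmin h h1 hk' hadj
    exact ⟨a, b, k, h, hk', rfl, rfl⟩
  · exact absurd hadj (G.irrefl)
  · obtain rfl := eq_succ_of_adj_same hmin h h1 hk hadj.symm
    exact IsEdge.symm ⟨a, b, k', h, hk, rfl, rfl⟩

lemma isEdge_or_isCross_of_branch (hmin : ∀ S, S ⊂ T.verts → ¬ G.HasK4Minor S) {c : Fin 4}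
    {w : V} (hw : w ∈ T.verts) (hadj : G.Adj (T.branch c) w) :
    T.IsEdge (T.branch c) w ∨ T.IsCross (T.branch c) w := by
  rcases verts_cases hw with ⟨d, rfl⟩ | ⟨a, b, k, hab, hk, hkl, rfl⟩
  · have hcd : c ≠ d := by rintro rfl; exact G.irrefl hadj
    left
    rw [← pt_zero (T := T) c d, ← pt_len hcd] at hadj ⊢
    exact isEdge_of_adj_same hmin hcd (Nat.zero_le _) le_rfl hadj
  · by_cases hca : c = a
    · subst hca
      left
      rw [← pt_zero (T := T) c b] at hadj ⊢
      exact isEdge_of_adj_same hmin hab (Nat.zero_le _) hkl.le hadj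
    by_cases hcb : c = b
    · subst hcb
      left
      rw [← pt_len hab] at hadj ⊢
      exact isEdge_of_adj_same hmin hab le_rfl hkl.le hadj
    exact Or.inr ⟨c, a, b, k, hca, hcb, hab, hk, hkl, rfl, rfl⟩

/-- In a minimal set with a `K₄`-minor, spanned by a subdivision of `K₄`, the only chords of the
subdivision join a branch vertex with an interior vertex of a path on the opposite side. -/
lemma isEdge_or_isCross (hg : 5 ≤ G.egirth) (hmin : ∀ S, S ⊂ T.verts → ¬ G.HasK4Minor S)
    {u w : V} (hu : u ∈ T.verts) (hw : w ∈ T.verts) (hadj : G.Adj u w) :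
    T.IsEdge u w ∨ T.IsCross u w ∨ T.IsCross w u := by
  rcases verts_cases hu with ⟨c, rfl⟩ | ⟨a, b, k, hab, hk, hkl, rfl⟩
  · exact (isEdge_or_isCross_of_branch hmin hw hadj).imp_right Or.inl
  rcases verts_cases hw with ⟨c, rfl⟩ | ⟨c, d, k', hcd, hk', hkl', rfl⟩
  · rcases isEdge_or_isCross_of_branch hmin hu hadj.symm with h | h
    · exact Or.inl h.symm
    · exact Or.inr (Or.inr h)
  have flip : ∀ {c d k'}, c ≠ d → k' < T.len c d → T.pt c d k' = T.pt d c (T.len d c - k') := by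
    intro c d k' hcd hkl'
    rw [len_comm, pt_comm hcd, Nat.sub_sub_self hkl'.le]
  -- For paths with a common end, both ends of the chord are next to it, which gives a triangle.
  have share : ∀ {a b d k k'}, a ≠ b → a ≠ d → b ≠ d → 0 < k → k < T.len a b → 0 < k' →
      k' < T.len a d → G.Adj (T.pt a b k) (T.pt a d k') → False := by
    intro a b d k k' hab had hbd hk hkl hk' hkl' hadj
    obtain rfl := eq_one_of_adj_adjacent hmin hab had hbd hk hkl hk' hkl' hadj
    obtain rfl := eq_one_of_adj_adjacent hmin had hab hbd.symm hk' hkl' hk hkl hadj.symm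
    have h1 := adj_pt (T := T) hab (k := 0) (by omega)
    have h2 := adj_pt (T := T) had (k := 0) (by omega)
    rw [pt_zero] at h1 h2
    exact not_triangle_of_five_le_egirth hg h1 hadj h2.symm
  have hl1 := len_comm (T := T) a b
  have hl2 := len_comm (T := T) c d
  by_cases hac : a = c
  · subst hac
    by_cases hbd : b = d
    · subst hbd
      exact Or.inl (isEdge_of_adj_same hmin hab hkl.le hkl'.le hadj)
    · exact (share hab hcd hbd hk hkl hk' hkl' hadj).elim
  by_cases had : a = d
  · subst had
    by_cases hbc : b = c
    · subst hbc
      rw [flip hcd hkl'] at hadj ⊢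
      exact Or.inl (isEdge_of_adj_same hmin hab hkl.le (by omega) hadj)
    · rw [flip hcd hkl'] at hadj
      exact (share hab hcd.symm hbc hk hkl (by omega) (by omega) hadj).elim
  by_cases hbc : b = c
  · subst hbc
    rw [flip hab hkl] at hadj
    exact (share hab.symm hcd had (by omega) (by omega) hk' hkl' hadj).elim
  by_cases hbd : b = d
  · subst hbd
    rw [flip hab hkl, flip hcd hkl'] at hadj
    exact (share hab.symm hcd.symm hac (by omega) (by omega) (by omega) (by omega) hadj).elim
  exfalso
  -- For opposite paths, the four paths between their ends are edges and form a 4-cycle.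
  have e1 := len_eq_one_of_adj_opposite hmin hab hac had hbc hbd hcd hk hkl hk' hkl' hadj
  have hadj2 := hadj
  rw [flip hcd hkl'] at hadj2
  have e2 := len_eq_one_of_adj_opposite hmin hab had hac hbd hbc hcd.symm hk hkl
    (by omega) (by omega) hadj2
  rw [flip hab hkl] at hadj hadj2
  have e3 := len_eq_one_of_adj_opposite hmin hab.symm hbc hbd hac had hcd (by omega) (by omega)
    hk' hkl' hadj
  have e4 := len_eq_one_of_adj_opposite hmin hab.symm hbd hbc had hac hcd.symm
    (by omega) (by omega) (by omega) (by omega) hadj2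
  exact not_four_cycle_of_five_le_egirth hg (adj_branch_of_len_eq_one hac e1)
    (adj_branch_of_len_eq_one hbc e3).symm (adj_branch_of_len_eq_one hbd e4)
    (adj_branch_of_len_eq_one had e2).symm (fun h => hab (T.branch_inj h))
    (fun h => hcd (T.branch_inj h))

end K4Model

end Chords

end SimpleGraph

/-! ### From minimal `K₄`-minors to wheels with four spokes. -/

namespace SimpleGraph

section Wheels

variable {V : Type*} {G : SimpleGraph V}

lemma IsHole.inj {h : ℕ → V} {m : ℕ} (hh : G.IsHole h m) {i j : ℕ} (hi : i < m) (hj : j < m)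
    (he : h i = h j) : i = j := by
  rcases Nat.lt_trichotomy i j with h1 | h1 | h1
  · exact absurd he (hh.ne i j h1 hj)
  · exact h1
  · exact absurd he.symm (hh.ne j i h1 hi)

namespace K4Model

variable {T : K4Model G}

lemma IsEdge.mem_edges {u w : V} (h : T.IsEdge u w) :
    ∃ (a b : Fin 4) (h : a ≠ b), s(u, w) ∈ (T.path a b h).edges := by
  obtain ⟨a, b, k, hab, hk, rfl, rfl⟩ := h
  refine ⟨a, b, hab, ?_⟩
  simp only [pt, len, dif_pos hab] at hk ⊢
  rw [Walk.edges_eq_zipWith_support, List.mem_iff_getElem]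
  refine ⟨k, by simpa using hk, ?_⟩
  simp [Walk.getVert_eq_support_getElem _ hk.le, Walk.getVert_eq_support_getElem _ hk]

/-- A subdivision of `K₄` without chords is an induced one. -/
lemma isSubdivisionOf_of_forall_isEdge
    (hT : ∀ u ∈ T.verts, ∀ w ∈ T.verts, G.Adj u w → T.IsEdge u w) :
    (G.induce T.verts).IsSubdivisionOf (completeGraph (Fin 4)) := by
  have hs : ∀ a b (h : a ≠ b), ∀ x ∈ (T.path a b h).support, x ∈ T.verts := fun a b h x hx =>
    mem_verts_of_mem_support h hx
  have hinj : Function.Injective (Embedding.induce (G := G) T.verts).toHom :=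
    (Embedding.induce (G := G) T.verts).injective
  have hmem : ∀ a b (h : a ≠ b) (x : T.verts),
      x ∈ ((T.path a b h).induce T.verts (hs a b h)).support ↔ (x : V) ∈ (T.path a b h).support := by
    intro a b h x
    rw [Walk.support_induce, List.mem_attachWith]
  refine ⟨⟨⟨fun a => ⟨T.branch a, branch_mem_verts a⟩, fun a b h =>
    T.branch_inj (Subtype.ext_iff.mp h)⟩, fun a b h => (T.path a b h).induce T.verts (hs a b h),
    ?_, ?_, ?_, ?_, ?_, ?_⟩⟩
  · intro a b h
    refine Walk.IsPath.of_map (f := (Embedding.induce (G := G) T.verts).toHom) ?_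
    rw [Walk.map_induce]
    exact T.isPath a b h
  · intro a b h
    apply Walk.map_injective_of_injective hinj
    rw [Walk.map_induce, ← Walk.reverse_map, Walk.map_induce]
    exact T.path_symm a b h
  · intro a b c h hc
    exact T.branch_mem a b c h ((hmem a b h _).mp hc)
  · intro a b c d h h' hne x hx hx'
    obtain ⟨w, hw⟩ := T.disjoint a b c d h h' hne x ((hmem a b h _).mp hx)
      ((hmem c d h' _).mp hx')
    exact ⟨w, Subtype.ext hw⟩
  · rintro ⟨x, a, b, k, hab, hk, rfl⟩
    exact Or.inr ⟨a, b, hab, (hmem a b hab _).mpr (pt_mem_support hab k)⟩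
  · intro x y hxy
    obtain ⟨a, b, h, he⟩ := (hT x x.2 y y.2 hxy).mem_edges
    refine ⟨a, b, h, ?_⟩
    have h1 : ((T.path a b h).induce T.verts (hs a b h)).edges.map
        (Sym2.map (Embedding.induce (G := G) T.verts).toHom) = (T.path a b h).edges := by
      rw [← Walk.edges_map, Walk.map_induce]
      rfl
    rw [← h1] at he
    obtain ⟨e, he, hee⟩ := List.mem_map.mp he
    have : e = s(x, y) := Sym2.map.injective hinj hee
    rwa [← this]

lemma pt_ne_pt_of_cyclic {a b c : Fin 4} (hab : a ≠ b) (hbc : b ≠ c) (hca : c ≠ a) {k k' : ℕ}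
    (hk : k < T.len a b) (hk' : k' < T.len b c) : T.pt a b k ≠ T.pt b c k' := by
  intro he
  rcases Nat.eq_zero_or_pos k with rfl | h0
  · rw [pt_zero] at he
    rcases branch_eq_pt hbc hk'.le he with ⟨h1, -⟩ | ⟨h1, -⟩
    · exact hab h1.symm
    · exact hca h1
  · rcases eq_of_pt_eq_pt hab hbc h0 hk hk'.le he with ⟨h1, -, -⟩ | ⟨-, h1, -⟩
    · exact hab h1.symm
    · exact hca h1

lemma cyclic_or_cyclic {α : Type*} {j m l a b : α} (ha : a = j ∨ a = m ∨ a = l)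
    (hb : b = j ∨ b = m ∨ b = l) (hab : a ≠ b) :
    ((a = j ∧ b = m) ∨ (a = m ∧ b = l) ∨ (a = l ∧ b = j)) ∨
      ((b = j ∧ a = m) ∨ (b = m ∧ a = l) ∨ (b = l ∧ a = j)) := by
  rcases ha with rfl | rfl | rfl <;> rcases hb with rfl | rfl | rfl <;> simp_all

/-- A chord of the only possible kind makes the minimal set a wheel. -/
lemma exists_wheel_of_isCross (hg : 5 ≤ G.egirth) (hmin : ∀ S, S ⊂ T.verts → ¬ G.HasK4Minor S)
    {u w : V} (hc : T.IsCross u w) (hadj : G.Adj u w) :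
    ∃ h n, G.IsHole h n ∧ u ∈ T.verts ∧ (∀ k < n, h k ∈ T.verts ∧ h k ≠ u) ∧
      ∃ a b c d, a < b ∧ b < c ∧ c < d ∧ d < n ∧ G.Adj u (h a) ∧ G.Adj u (h b) ∧
        G.Adj u (h c) ∧ G.Adj u (h d) := by
  obtain ⟨i, j, m, κ, hij, him, hjm, hκ, hκl, rfl, rfl⟩ := hc
  obtain ⟨l, hil, hjl, hml, hall⟩ : ∃ l, i ≠ l ∧ j ≠ l ∧ m ≠ l ∧
      ∀ o, o = i ∨ o = j ∨ o = m ∨ o = l := by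
    clear hadj hκl
    revert i j m
    decide
  have eij := len_eq_one_of_branch_adj hmin hij him hjm hκ hκl hadj
  have eim : T.len i m = 1 := by
    refine len_eq_one_of_branch_adj hmin him hij hjm.symm (k := T.len j m - κ) (by omega)
      (by have := len_comm (T := T) j m; omega) ?_
    rwa [pt_comm hjm, Nat.sub_sub_self hκl.le]
  have eil := len_eq_one_of_branch_adj' hmin hij him hil hjm hjl hml hκ hκl hadj
  have ei : ∀ o, i ≠ o → T.len i o = 1 := by
    intro o ho
    rcases hall o with rfl | rfl | rfl | rfl
    · exact absurd rfl ho
    · exact eij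
    · exact eim
    · exact eil
  have l1 := len_pos (T := T) hjm
  have l2 := len_pos (T := T) hml
  have l3 := len_pos (T := T) hjl.symm
  -- The hole runs through the paths from `j` to `m`, from `m` to `l` and from `l` back to `j`; the
  -- center is the branch vertex of `i`.
  set h : ℕ → V := fun k => if k < T.len j m then T.pt j m k else
    if k < T.len j m + T.len m l then T.pt m l (k - T.len j m) else
    T.pt l j (k - (T.len j m + T.len m l)) with hdef
  set n := T.len j m + T.len m l + T.len l j with hn
  have h1 : ∀ k, k ≤ T.len j m → h k = T.pt j m k := by
    intro k hk
    rcases hk.lt_or_eq with hk | rfl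
    · simp [hdef, hk]
    · simp [hdef, l2, pt_len hjm, pt_zero]
  have h2 : ∀ k, k ≤ T.len m l → h (T.len j m + k) = T.pt m l k := by
    intro k hk
    rcases hk.lt_or_eq with hk | rfl
    · simp [hdef, hk]
    · simp [hdef, pt_len hml, pt_zero]
  have h3 : ∀ k, h (T.len j m + T.len m l + k) = T.pt l j k := by
    intro k
    have e1 : ¬ (T.len j m + T.len m l + k < T.len j m) := by omega
    have e2 : ¬ (T.len j m + T.len m l + k < T.len j m + T.len m l) := by omega
    simp only [hdef, if_neg e1, if_neg e2, Nat.add_sub_cancel_left]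
  have hcase : ∀ k < n, (∃ k1 < T.len j m, k = k1) ∨ (∃ k1 < T.len m l, k = T.len j m + k1) ∨
      ∃ k1 < T.len l j, k = T.len j m + T.len m l + k1 := by
    intro k hk
    by_cases c1 : k < T.len j m
    · exact Or.inl ⟨k, c1, rfl⟩
    by_cases c2 : k < T.len j m + T.len m l
    · exact Or.inr (Or.inl ⟨k - T.len j m, by omega, by omega⟩)
    · exact Or.inr (Or.inr ⟨k - (T.len j m + T.len m l), by omega, by omega⟩)
  have hverts : ∀ k < n, h k ∈ T.verts := by
    intro k hk
    rcases hcase k hk with ⟨k1, hk1, rfl⟩ | ⟨k1, hk1, rfl⟩ | ⟨k1, hk1, rfl⟩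
    · exact ⟨j, m, _, hjm, hk1.le, (h1 _ hk1.le).symm⟩
    · exact ⟨m, l, _, hml, hk1.le, (h2 _ hk1.le).symm⟩
    · exact ⟨l, j, _, hjl.symm, hk1.le, (h3 _).symm⟩
  have hbr : ∀ k < n, h k ≠ T.branch i := by
    intro k hk he
    rcases hcase k hk with ⟨k1, hk1, rfl⟩ | ⟨k1, hk1, rfl⟩ | ⟨k1, hk1, rfl⟩
    · rw [h1 _ hk1.le] at he
      rcases branch_eq_pt hjm hk1.le he.symm with ⟨e, -⟩ | ⟨e, -⟩
      · exact hij e.symm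
      · exact him e.symm
    · rw [h2 _ hk1.le] at he
      rcases branch_eq_pt hml hk1.le he.symm with ⟨e, -⟩ | ⟨e, -⟩
      · exact him e.symm
      · exact hil e.symm
    · rw [h3] at he
      rcases branch_eq_pt hjl.symm hk1.le he.symm with ⟨e, -⟩ | ⟨e, -⟩
      · exact hil e.symm
      · exact hij e.symm
  have hcase' : ∀ k < n, (∃ k1 < T.len j m, k = k1 ∧ h k = T.pt j m k1) ∨
      (∃ k1 < T.len m l, k = T.len j m + k1 ∧ h k = T.pt m l k1) ∨
      ∃ k1 < T.len l j, k = T.len j m + T.len m l + k1 ∧ h k = T.pt l j k1 := by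
    intro k hk
    rcases hcase k hk with ⟨k1, hk1, rfl⟩ | ⟨k1, hk1, rfl⟩ | ⟨k1, hk1, rfl⟩
    · exact Or.inl ⟨_, hk1, rfl, h1 _ hk1.le⟩
    · exact Or.inr (Or.inl ⟨_, hk1, rfl, h2 _ hk1.le⟩)
    · exact Or.inr (Or.inr ⟨_, hk1, rfl, h3 _⟩)
  have hne : ∀ p q, p < q → q < n → h p ≠ h q := by
    intro p q hpq hq he
    rcases hcase' p (by omega) with ⟨p1, hp1, ep, vp⟩ | ⟨p1, hp1, ep, vp⟩ | ⟨p1, hp1, ep, vp⟩ <;>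
    rcases hcase' q hq with ⟨q1, hq1, eq, vq⟩ | ⟨q1, hq1, eq, vq⟩ | ⟨q1, hq1, eq, vq⟩ <;>
    rw [vp, vq] at he
    · have := pt_inj hjm hp1.le hq1.le he; omega
    · exact pt_ne_pt_of_cyclic hjm hml hjl.symm hp1 hq1 he
    · exact pt_ne_pt_of_cyclic hjl.symm hjm hml hq1 hp1 he.symm
    · omega
    · have := pt_inj hml hp1.le hq1.le he; omega
    · exact pt_ne_pt_of_cyclic hml hjl.symm hjm hp1 hq1 he
    · omega
    · omega
    · have := pt_inj hjl.symm hp1.le hq1.le he; omega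
  have hinj : ∀ p q, p < n → q < n → h p = h q → p = q := by
    intro p q hp hq he
    rcases Nat.lt_trichotomy p q with c | c | c
    · exact absurd he (hne p q c hq)
    · exact c
    · exact absurd he.symm (hne q p c hp)
  have h30 : T.pt l j (T.len l j) = h 0 := by
    rw [h1 0 (Nat.zero_le _), pt_len hjl.symm, pt_zero]
  have hsucc : ∀ k, k + 1 < n → G.Adj (h k) (h (k + 1)) := by
    intro k hk
    rcases hcase k (by omega) with ⟨k1, hk1, rfl⟩ | ⟨k1, hk1, rfl⟩ | ⟨k1, hk1, rfl⟩
    · rw [h1 _ hk1.le, h1 _ hk1]; exact adj_pt hjm hk1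
    · rw [add_assoc, h2 _ hk1.le, h2 _ hk1]; exact adj_pt hml hk1
    · rw [add_assoc _ k1, h3, h3]; exact adj_pt hjl.symm hk1
  have hlast : G.Adj (h (n - 1)) (h 0) := by
    have e : n - 1 = T.len j m + T.len m l + (T.len l j - 1) := by omega
    rw [← h30, e, h3]
    have := adj_pt (T := T) hjl.symm (k := T.len l j - 1) (by omega)
    rwa [Nat.sub_add_cancel l3] at this
  have hedge' : ∀ a b k, a ≠ b → k < T.len a b → i ≠ a → i ≠ b →
      ∃ p < n, (T.pt a b k = h p ∧ T.pt a b (k + 1) = h (if p + 1 = n then 0 else p + 1)) ∨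
        (T.pt a b (k + 1) = h p ∧ T.pt a b k = h (if p + 1 = n then 0 else p + 1)) := by
    have main : ∀ a b k, k < T.len a b → (a = j ∧ b = m) ∨ (a = m ∧ b = l) ∨ (a = l ∧ b = j) →
        ∃ p < n, T.pt a b k = h p ∧ T.pt a b (k + 1) = h (if p + 1 = n then 0 else p + 1) := by
      intro a b k hk hab
      rcases hab with ⟨rfl, rfl⟩ | ⟨rfl, rfl⟩ | ⟨rfl, rfl⟩
      · refine ⟨k, by omega, (h1 _ hk.le).symm, ?_⟩
        rw [if_neg (by omega), h1 _ hk]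
      · refine ⟨_, by omega, (h2 _ hk.le).symm, ?_⟩
        rw [if_neg (by omega), add_assoc, h2 _ hk]
      · refine ⟨_, by omega, (h3 _).symm, ?_⟩
        split_ifs with c
        · rw [← h30]; congr 1; omega
        · rw [add_assoc _ k, h3]
    intro a b k hab hk ha hb
    have hab' : ((a = j ∧ b = m) ∨ (a = m ∧ b = l) ∨ (a = l ∧ b = j)) ∨
        ((b = j ∧ a = m) ∨ (b = m ∧ a = l) ∨ (b = l ∧ a = j)) :=
      cyclic_or_cyclic ((hall a).resolve_left ha.symm) ((hall b).resolve_left hb.symm) hab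
    rcases hab' with hab' | hab'
    · obtain ⟨p, hp, h⟩ := main a b k hk hab'
      exact ⟨p, hp, Or.inl h⟩
    · have hlc := len_comm (T := T) a b
      obtain ⟨p, hp, e1, e2⟩ := main b a (T.len a b - (k + 1)) (by omega) hab'
      rw [pt_comm hab, Nat.sub_sub_self (by omega)] at e1
      rw [pt_comm hab, show T.len a b - (T.len a b - (k + 1) + 1) = k by omega] at e2
      exact ⟨p, hp, Or.inr ⟨e1, e2⟩⟩
  -- The paths at `i` are single edges, so an edge of the subdivision that avoids the center lies on
  -- the hole.
  have hedge : ∀ p q, p < n → q < n → T.IsEdge (h p) (h q) →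
      q = (if p + 1 = n then 0 else p + 1) ∨ p = (if q + 1 = n then 0 else q + 1) := by
    rintro p q hp hq ⟨a, b, k, hab, hk, e1, e2⟩
    have hia : i ≠ a := by
      rintro rfl
      have : T.len i b = 1 := ei b hab
      obtain rfl : k = 0 := by omega
      rw [pt_zero] at e1
      exact hbr p hp e1
    have hib : i ≠ b := by
      rintro rfl
      have hlc := len_comm (T := T) a i
      have : T.len i a = 1 := ei a hia
      rw [show k + 1 = T.len a i by omega, pt_len hab] at e2
      exact hbr q hq e2
    have hlt : ∀ r, r < n → (if r + 1 = n then 0 else r + 1) < n := by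
      intro r hr; split_ifs <;> omega
    obtain ⟨r, hr, ⟨e3, e4⟩ | ⟨e3, e4⟩⟩ := hedge' a b k hab hk hia hib
    · obtain rfl := hinj p r hp hr (e1.trans e3)
      exact Or.inl (hinj q _ hq (hlt _ hp) (e2.trans e4))
    · obtain rfl := hinj q r hq hr (e2.trans e3)
      exact Or.inr (hinj p _ hp (hlt _ hq) (e1.trans e4))
  -- A chord of the hole at a branch vertex `i'` would make `i'` adjacent to another branch vertex
  -- `j'`; both are adjacent to the center, so a triangle arises.
  have hcross : ∀ p q, p < n → q < n → G.Adj (h p) (h q) → ¬ T.IsCross (h p) (h q) := by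
    rintro p q hp hq had ⟨i', j', m', k, hij', him', hjm', hk, hkl, e1, e2⟩
    have hii : i ≠ i' := by rintro rfl; exact hbr p hp e1
    have hlc := len_comm (T := T) j' m'
    have hji : i ≠ j' := by
      rintro rfl
      have := ei m' hjm'
      omega
    rw [e1, e2] at had
    exact not_triangle_of_five_le_egirth hg (adj_branch_of_len_eq_one hii (ei _ hii))
      (adj_branch_of_len_eq_one hij' (len_eq_one_of_branch_adj hmin hij' him' hjm' hk hkl had))
      (adj_branch_of_len_eq_one hji (ei _ hji)).symm
  have ab : ∀ o, i ≠ o → G.Adj (T.branch i) (T.branch o) := fun o ho =>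
    adj_branch_of_len_eq_one ho (ei o ho)
  refine ⟨h, n, ⟨by omega, hne, ?_⟩, branch_mem_verts i, fun k hk => ⟨hverts k hk, hbr k hk⟩,
    0, κ, T.len j m, T.len j m + T.len m l, hκ, hκl, by omega, by omega, ?_, ?_, ?_, ?_⟩
  · intro p q hpq hq
    constructor
    · intro had
      have hpn : p < n := by omega
      rcases isEdge_or_isCross hg hmin (hverts p hpn) (hverts q hq) had with hE | hE | hE
      · rcases hedge p q hpn hq hE with e | e <;> split_ifs at e <;> omega
      · exact absurd hE (hcross p q hpn hq had)
      · exact absurd hE (hcross q p hq hpn had.symm)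
    · rintro (rfl | ⟨rfl, hqn⟩)
      · exact hsucc p hq
      · rw [show q = n - 1 by omega]
        exact hlast.symm
  · rw [h1 0 (Nat.zero_le _), pt_zero]; exact ab j hij
  · rw [h1 κ hκl.le]; exact hadj
  · rw [h1 _ le_rfl, pt_len hjm]; exact ab m him
  · rw [h2 _ le_rfl, pt_len hml]; exact ab l hil

end K4Model

/-- In an ISK4-free graph of girth at least five, a set with a `K₄`-minor contains a wheel with
at least four spokes. -/
theorem exists_wheel_of_hasK4Minor [Finite V] (hfree : G.ISK4Free) (hg : 5 ≤ G.egirth) {S : Set V}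
    (hS : G.HasK4Minor S) : ∃ x h n, G.IsHole h n ∧ x ∈ S ∧ (∀ k < n, h k ∈ S ∧ h k ≠ x) ∧
      ∃ a b c d, a < b ∧ b < c ∧ c < d ∧ d < n ∧ G.Adj x (h a) ∧ G.Adj x (h b) ∧
        G.Adj x (h c) ∧ G.Adj x (h d) := by
  -- A subdivision inside an inclusion-minimal set with a `K₄`-minor must fill that set.
  obtain ⟨S₀, hS₀S, hS₀⟩ := (Set.toFinite {S : Set V | G.HasK4Minor S}).exists_le_minimal hS
  obtain ⟨T, hT⟩ := hS₀.prop.exists_model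
  have hTS : T.verts = S₀ := hS₀.eq_of_le T.hasK4Minor_verts hT
  have hmin : ∀ S, S ⊂ T.verts → ¬ G.HasK4Minor S := fun S hS h =>
    hS.2 (hTS ▸ hS₀.le_of_le h (hTS ▸ hS.1))
  have key : ∀ u w, T.IsCross u w → G.Adj u w → ∃ x h n, G.IsHole h n ∧ x ∈ S ∧
      (∀ k < n, h k ∈ S ∧ h k ≠ x) ∧
      ∃ a b c d, a < b ∧ b < c ∧ c < d ∧ d < n ∧ G.Adj x (h a) ∧ G.Adj x (h b) ∧
        G.Adj x (h c) ∧ G.Adj x (h d) := by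
    intro u w hc hadj
    obtain ⟨h, n, hh, hu, hk, hs⟩ := K4Model.exists_wheel_of_isCross hg hmin hc hadj
    exact ⟨u, h, n, hh, hS₀S (hT hu), fun k hkn => ⟨hS₀S (hT (hk k hkn).1), (hk k hkn).2⟩, hs⟩
  by_contra hno
  refine hfree T.verts (K4Model.isSubdivisionOf_of_forall_isEdge fun u hu w hw hadj => ?_)
  rcases K4Model.isEdge_or_isCross hg hmin hu hw hadj with h | h | h
  · exact h
  · exact absurd (key u w h hadj) hno
  · exact absurd (key w u h hadj.symm) hno

/-- In an ISK4-free graph of girth at least five, no set of vertices with a `K₄`-minor induces a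
subgraph of maximum degree at most three. -/
theorem false_of_hasK4Minor_of_degree_le_three [Finite V] (hfree : G.ISK4Free)
    (hg : 5 ≤ G.egirth) {S : Set V} (hS : G.HasK4Minor S)
    (hdeg : ∀ v ∈ S, ∃ a b c, ∀ w ∈ S, G.Adj v w → w = a ∨ w = b ∨ w = c) : False := by
  obtain ⟨x, h, n, hh, hx, hk, i₁, i₂, i₃, i₄, h12, h23, h34, h4, a1, a2, a3, a4⟩ :=
    exists_wheel_of_hasK4Minor hfree hg hS
  obtain ⟨a, b, c, habc⟩ := hdeg x hx
  have n12 := hh.ne i₁ i₂ h12 (by omega)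
  have n13 := hh.ne i₁ i₃ (by omega) (by omega)
  have n14 := hh.ne i₁ i₄ (by omega) (by omega)
  have n23 := hh.ne i₂ i₃ (by omega) (by omega)
  have n24 := hh.ne i₂ i₄ (by omega) (by omega)
  have n34 := hh.ne i₃ i₄ (by omega) (by omega)
  -- Four distinct spoke ends do not fit among three possible neighbours of the center.
  rcases habc _ (hk i₁ (by omega)).1 a1 with e1 | e1 | e1 <;>
  rcases habc _ (hk i₂ (by omega)).1 a2 with e2 | e2 | e2 <;>
  rcases habc _ (hk i₃ (by omega)).1 a3 with e3 | e3 | e3 <;>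
  rcases habc _ (hk i₄ (by omega)).1 a4 with e4 | e4 | e4 <;>
  simp_all

end Wheels

end SimpleGraph

/-! ### Fourth spokes, rerouted holes, and a first configuration of maximum degree three. -/

namespace SimpleGraph

section Certificates

variable {V : Type*} {G : SimpleGraph V}

lemma IsHole.adj_iff' {h : ℕ → V} {n : ℕ} (hh : G.IsHole h n) {i j : ℕ} (hi : i < n)
    (hj : j < n) : G.Adj (h i) (h j) ↔
      j = i + 1 ∨ i = j + 1 ∨ (i = 0 ∧ j + 1 = n) ∨ (j = 0 ∧ i + 1 = n) := by
  have := hh.four_le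
  rcases Nat.lt_trichotomy i j with h1 | h1 | h1
  · rw [hh.adj_iff i j h1 hj]; omega
  · subst h1
    simp
    omega
  · rw [G.adj_comm, hh.adj_iff j i h1 hi]; omega

lemma IsHole.adj_succ {h : ℕ → V} {n : ℕ} (hh : G.IsHole h n) {i : ℕ} (hi : i + 1 < n) :
    G.Adj (h i) (h (i + 1)) := (hh.adj_iff i (i + 1) (by omega) hi).mpr (Or.inl rfl)

lemma IsHole.adj_last {h : ℕ → V} {n : ℕ} (hh : G.IsHole h n) : G.Adj (h 0) (h (n - 1)) := by
  have := hh.four_le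
  exact (hh.adj_iff 0 (n - 1) (by omega) (by omega)).mpr (Or.inr ⟨rfl, by omega⟩)

lemma IsHole.rotate {h : ℕ → V} {n : ℕ} (hh : G.IsHole h n) {r : ℕ} (hr : r < n) :
    G.IsHole (fun k => if k + r < n then h (k + r) else h (k + r - n)) n where
  four_le := hh.four_le
  ne i j hij hj he := by
    split_ifs at he <;> have := hh.inj (by omega) (by omega) he <;> omega
  adj_iff i j hij hj := by
    have := hh.four_le
    split_ifs <;> rw [hh.adj_iff' (by omega) (by omega)] <;> omega

lemma IsHole.isInducedPath {h : ℕ → V} {n : ℕ} (hh : G.IsHole h n) {N : ℕ} (hN : N + 1 < n) :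
    G.IsInducedPath h N where
  ne i j hij hj := hh.ne i j hij (by omega)
  adj_iff i j hij hj := by rw [hh.adj_iff i j hij (by omega)]; omega

/-- The branch sets are the center and three arcs of the hole, with one spoke end in each. -/
lemma IsHole.hasK4Minor {h : ℕ → V} {n : ℕ} (hh : G.IsHole h n) {x : V}
    (hx : ∀ k < n, h k ≠ x) {i j k : ℕ} (hij : i < j) (hjk : j < k) (hk : k < n)
    (ai : G.Adj x (h i)) (aj : G.Adj x (h j)) (ak : G.Adj x (h k)) :
    G.HasK4Minor {v | v = x ∨ ∃ k < n, h k = v} := by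
  have hc : ∀ p q, p < q → q ≤ n → (G.induce (arc h p q)).Connected := fun p q hpq hq =>
    connected_induce_arc hpq fun k _ hk => hh.adj_succ (by omega)
  have hd : ∀ p q r s, q ≤ r → s ≤ n → ∀ v ∈ arc h p q, v ∉ arc h r s := by
    rintro p q r s hqr hs v ⟨k, hk1, hk2, rfl⟩ ⟨k', hk1', hk2', he⟩
    have := hh.inj (by omega) (by omega) he
    omega
  have hxd : ∀ p q, q ≤ n → ∀ v ∈ ({x} : Set V), v ∉ arc h p q := by
    rintro p q hq v rfl ⟨k, hk1, hk2, he⟩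
    exact hx k (by omega) he
  refine (hasK4Minor_of_sets {x} (arc h 0 (i + 1)) (arc h (i + 1) (j + 1)) (arc h (j + 1) n)
    (connected_induce_singleton x) (hc _ _ (by omega) (by omega)) (hc _ _ (by omega) (by omega))
    (hc _ _ (by omega) (by omega)) (hxd _ _ (by omega)) (hxd _ _ (by omega)) (hxd _ _ le_rfl)
    (hd _ _ _ _ (by omega) (by omega)) (hd _ _ _ _ (by omega) (by omega))
    (hd _ _ _ _ (by omega) (by omega))
    ⟨x, rfl, _, mem_arc (by omega) (by omega), ai⟩ ⟨x, rfl, _, mem_arc (by omega) (by omega), aj⟩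
    ⟨x, rfl, _, mem_arc (by omega) (by omega), ak⟩
    ⟨h i, mem_arc (by omega) (by omega), _, mem_arc (by omega) (by omega),
      hh.adj_succ (by omega)⟩
    ⟨h 0, mem_arc (by omega) (by omega), h (n - 1), mem_arc (by omega) (by omega), hh.adj_last⟩
    ⟨h j, mem_arc (by omega) (by omega), _, mem_arc (by omega) (by omega),
      hh.adj_succ (by omega)⟩).mono ?_
  rintro v (((rfl | ⟨k, -, hk', rfl⟩) | ⟨k, -, hk', rfl⟩) | ⟨k, -, hk', rfl⟩)
  · exact Or.inl rfl
  · exact Or.inr ⟨k, by omega, rfl⟩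
  · exact Or.inr ⟨k, by omega, rfl⟩
  · exact Or.inr ⟨k, by omega, rfl⟩

/-- A wheel in an ISK4-free graph of girth at least five has at least four spokes. -/
lemma IsHole.exists_fourth_spoke [Finite V] (hfree : G.ISK4Free) (hg : 5 ≤ G.egirth) {h : ℕ → V}
    {n : ℕ} (hh : G.IsHole h n) {x : V} (hx : ∀ k < n, h k ≠ x) {i j k : ℕ} (hij : i < j)
    (hjk : j < k) (hk : k < n) (ai : G.Adj x (h i)) (aj : G.Adj x (h j)) (ak : G.Adj x (h k)) :
    ∃ l < n, l ≠ i ∧ l ≠ j ∧ l ≠ k ∧ G.Adj x (h l) := by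
  by_contra hno
  refine false_of_hasK4Minor_of_degree_le_three hfree hg
    (hh.hasK4Minor hx hij hjk hk ai aj ak) ?_
  rintro v (rfl | ⟨p, hp, rfl⟩)
  · refine ⟨h i, h j, h k, ?_⟩
    rintro w (rfl | ⟨q, hq, rfl⟩) hw
    · exact absurd hw G.irrefl
    · by_contra hne
      push Not at hne
      exact hno ⟨q, hq, by rintro rfl; exact hne.1 rfl, by rintro rfl; exact hne.2.1 rfl,
        by rintro rfl; exact hne.2.2 rfl, hw⟩
  · refine ⟨x, h (if p + 1 = n then 0 else p + 1), h (if p = 0 then n - 1 else p - 1), ?_⟩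
    rintro w (rfl | ⟨q, hq, rfl⟩) hw
    · exact Or.inl rfl
    · rw [hh.adj_iff' hp hq] at hw
      rcases hw with rfl | rfl | ⟨rfl, hw⟩ | ⟨rfl, hw⟩
      · rw [if_neg (by omega)]; exact Or.inr (Or.inl rfl)
      · rw [if_neg (Nat.succ_ne_zero q)]; exact Or.inr (Or.inr rfl)
      · rw [if_pos rfl, ← hw]; exact Or.inr (Or.inr rfl)
      · rw [if_pos hw]; exact Or.inr (Or.inl rfl)

/-- The vertices strictly between positions `q` and `w` of `h` are replaced by `g 0, …, g s`. -/
def splice (h g : ℕ → V) (q s w : ℕ) (k : ℕ) : V :=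
  if k ≤ q then h k else if k ≤ q + s + 1 then g (k - (q + 1)) else h (k - (q + s + 2) + w)

/-- The value `w = n` stands for position `0`: then `g s` closes up with `h 0`. The bound `2 ≤ q`
makes the new hole long enough. -/
lemma IsHole.splice {h g : ℕ → V} {n q s w : ℕ} (hh : G.IsHole h n) (hqw : q + 1 < w) (hw : w ≤ n)
    (hg : G.IsInducedPath g s) (hd : ∀ i ≤ s, ∀ j < n, j ≤ q ∨ w ≤ j → g i ≠ h j)
    (ha : ∀ i ≤ s, ∀ j < n, j ≤ q ∨ w ≤ j → (G.Adj (g i) (h j) ↔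
      (i = 0 ∧ j = q) ∨ (i = s ∧ (j = w ∨ (w = n ∧ j = 0)))))
    (hlen : 2 ≤ q) : G.IsHole (SimpleGraph.splice h g q s w) (q + s + 2 + (n - w)) where
  four_le := by omega
  ne i j hij hj he := by
    unfold SimpleGraph.splice at he
    split_ifs at he
    · have := hh.inj (by omega) (by omega) he; omega
    · exact hd _ (by omega) _ (by omega) (by omega) he.symm
    · have := hh.inj (by omega) (by omega) he; omega
    · omega
    · have := hg.inj (by omega) (by omega) he; omega
    · exact hd _ (by omega) _ (by omega) (by omega) he
    · omega
    · omega
    · have := hh.inj (by omega) (by omega) he; omega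
  adj_iff i j hij hj := by
    unfold SimpleGraph.splice
    split_ifs
    · rw [hh.adj_iff' (by omega) (by omega)]; omega
    · rw [G.adj_comm, ha _ (by omega) _ (by omega) (by omega)]; omega
    · rw [hh.adj_iff' (by omega) (by omega)]; omega
    · omega
    · rw [hg.adj_iff' (by omega) (by omega)]; omega
    · rw [ha _ (by omega) _ (by omega) (by omega)]; omega
    · omega
    · omega
    · rw [hh.adj_iff' (by omega) (by omega)]; omega

/-- Two nonadjacent vertices `x` and `g s`, joined by a path, both with one neighbour on either
side of a path `A`, yield a subdivision of `K₄`. -/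
lemma false_of_nested_feet [Finite V] (hfree : G.ISK4Free) (hgirth : 5 ≤ G.egirth)
    {A g : ℕ → V} {N s α₁ α₂ β₁ β₂ k : ℕ} {x : V} (hA : G.IsInducedPath A N)
    (hg : G.IsInducedPath g s) (hs : 1 ≤ s) (hgA : ∀ i ≤ s, ∀ j ≤ N, g i ≠ A j)
    (hxA : ∀ j ≤ N, A j ≠ x) (hxg : ∀ i ≤ s, g i ≠ x)
    (axA : ∀ j ≤ N, G.Adj x (A j) ↔ j = α₁ ∨ j = α₂)
    (axg : ∀ i ≤ s, G.Adj x (g i) ↔ i = 0)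
    (avA : ∀ j ≤ N, G.Adj (g s) (A j) ↔ j = β₁ ∨ j = β₂)
    (agA : ∀ i, 0 < i → i < s → ∀ j ≤ N, ¬ G.Adj (g i) (A j))
    (a0A : ∀ j ≤ N, G.Adj (g 0) (A j) → j = N ∧ α₂ < N)
    (hα₁ : α₁ ≤ k) (hβ₁ : β₁ ≤ k) (hα₂ : k < α₂) (hβ₂ : k < β₂) (hα : α₂ ≤ N) (hβ : β₂ ≤ N)
    (h1 : α₁ = β₁ → α₁ = 0) (h2 : α₂ = β₂ → α₂ = N) : False := by
  have cA : ∀ p q, p < q → q ≤ N + 1 → (G.induce (arc A p q)).Connected := fun p q hpq hq =>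
    connected_induce_arc hpq fun k _ hk => (hA.adj_iff k (k + 1) (by omega) (by omega)).mpr rfl
  have cg : (G.induce (arc g 0 s)).Connected :=
    connected_induce_arc hs fun k _ hk => (hg.adj_iff k (k + 1) (by omega) (by omega)).mpr rfl
  -- The path `A` is cut between positions `k` and `k + 1`; `x` and `g s` have a foot on either
  -- side, and the rest of `g` is added to `x`.
  have hminor := hasK4Minor_of_sets (G := G) ({x} ∪ arc g 0 s) {g s} (arc A 0 (k + 1))
    (arc A (k + 1) (N + 1))
    (connected_induce_union_of_adj (connected_induce_singleton x) cg
      ⟨x, rfl, g 0, mem_arc le_rfl hs, (axg 0 (Nat.zero_le _)).mpr rfl⟩)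
    (connected_induce_singleton _) (cA _ _ (by omega) (by omega)) (cA _ _ (by omega) (by omega))
    (by
      rintro v (rfl | ⟨i, -, hi, rfl⟩) he
      · exact hxg s le_rfl he.symm
      · exact hg.ne i s hi le_rfl he)
    (by
      rintro v (rfl | ⟨i, -, hi, rfl⟩) ⟨j, hj, hj', he⟩
      · exact hxA j (by omega) he
      · exact hgA i hi.le j (by omega) he.symm)
    (by
      rintro v (rfl | ⟨i, -, hi, rfl⟩) ⟨j, hj, hj', he⟩
      · exact hxA j (by omega) he
      · exact hgA i hi.le j (by omega) he.symm)
    (by rintro v rfl ⟨j, hj, hj', he⟩; exact hgA s le_rfl j (by omega) he.symm)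
    (by rintro v rfl ⟨j, hj, hj', he⟩; exact hgA s le_rfl j (by omega) he.symm)
    (by
      rintro v ⟨i, hi, hi', rfl⟩ ⟨j, hj, hj', he⟩
      have := hA.inj (by omega) (by omega) he
      omega)
    ⟨g (s - 1), Or.inr (mem_arc (by omega) (by omega)), _, rfl,
      (hg.adj_iff _ _ (by omega) le_rfl).mpr (by omega)⟩
    ⟨x, Or.inl rfl, _, mem_arc (by omega) (by omega), (axA α₁ (by omega)).mpr (Or.inl rfl)⟩
    ⟨x, Or.inl rfl, _, mem_arc (by omega) (by omega), (axA α₂ (by omega)).mpr (Or.inr rfl)⟩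
    ⟨_, rfl, _, mem_arc (by omega) (by omega), (avA β₁ (by omega)).mpr (Or.inl rfl)⟩
    ⟨_, rfl, _, mem_arc (by omega) (by omega), (avA β₂ (by omega)).mpr (Or.inr rfl)⟩
    ⟨A k, mem_arc (by omega) (by omega), A (k + 1), mem_arc (by omega) (by omega),
      (hA.adj_iff k (k + 1) (by omega) (by omega)).mpr rfl⟩
  have hmem : ∀ w ∈ (({x} ∪ arc g 0 s) ∪ {g s} ∪ arc A 0 (k + 1) ∪ arc A (k + 1) (N + 1) : Set V),
      w = x ∨ (∃ i ≤ s, w = g i) ∨ ∃ j ≤ N, w = A j := by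
    rintro w ((((rfl | ⟨i, -, hi, rfl⟩) | rfl) | ⟨j, -, hj, rfl⟩) | ⟨j, -, hj, rfl⟩)
    · exact Or.inl rfl
    · exact Or.inr (Or.inl ⟨i, hi.le, rfl⟩)
    · exact Or.inr (Or.inl ⟨s, le_rfl, rfl⟩)
    · exact Or.inr (Or.inr ⟨j, by omega, rfl⟩)
    · exact Or.inr (Or.inr ⟨j, by omega, rfl⟩)
  refine false_of_hasK4Minor_of_degree_le_three hfree hgirth hminor fun v hv => ?_
  suffices hsuf : ∃ a b c, ∀ w, (w = x ∨ (∃ i ≤ s, w = g i) ∨ ∃ j ≤ N, w = A j) → G.Adj v w →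
      w = a ∨ w = b ∨ w = c by
    obtain ⟨a, b, c, habc⟩ := hsuf
    exact ⟨a, b, c, fun w hw => habc w (hmem w hw)⟩
  rcases hmem v hv with rfl | ⟨i, hi, rfl⟩ | ⟨j, hj, rfl⟩
  · refine ⟨g 0, A α₁, A α₂, ?_⟩
    rintro w (rfl | ⟨i, hi, rfl⟩ | ⟨j, hj, rfl⟩) hw
    · exact absurd hw G.irrefl
    · rw [(axg i hi).mp hw]; exact Or.inl rfl
    · rcases (axA j hj).mp hw with rfl | rfl <;> simp
  · rcases Nat.eq_zero_or_pos i with rfl | h0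
    · refine ⟨x, g 1, A N, ?_⟩
      rintro w (rfl | ⟨i', hi', rfl⟩ | ⟨j, hj, rfl⟩) hw
      · exact Or.inl rfl
      · rw [hg.adj_iff' hi hi'] at hw
        rw [show i' = 1 by omega]; simp
      · rw [(a0A j hj hw).1]; simp
    rcases hi.lt_or_eq with hi' | rfl
    · refine ⟨g (i - 1), g (i + 1), x, ?_⟩
      rintro w (rfl | ⟨i', hi', rfl⟩ | ⟨j, hj, rfl⟩) hw
      · simp
      · rw [hg.adj_iff' hi hi'] at hw
        rcases hw with rfl | rfl <;> simp
      · exact absurd hw (agA i h0 hi' j hj)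
    · refine ⟨g (i - 1), A β₁, A β₂, ?_⟩
      rintro w (rfl | ⟨i', hi', rfl⟩ | ⟨j, hj, rfl⟩) hw
      · have := (axg i le_rfl).mp hw.symm
        omega
      · rw [hg.adj_iff' hi hi'] at hw
        rw [show i' = i - 1 by omega]; simp
      · rcases (avA j hj).mp hw with rfl | rfl <;> simp
  · have hgj : ∀ i ≤ s, G.Adj (A j) (g i) → i = s ∨ (i = 0 ∧ j = N ∧ α₂ < N) := by
      intro i hi hadj
      by_cases h0 : i = 0
      · subst h0; exact Or.inr ⟨rfl, a0A j hj hadj.symm⟩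
      by_cases h0' : i = s
      · exact Or.inl h0'
      · exact absurd hadj.symm (agA i (by omega) (by omega) j hj)
    have main : ∀ c, (∀ w, w = x ∨ (∃ i ≤ s, w = g i) → G.Adj (A j) w → w = c) →
        ∃ a b c, ∀ w, (w = x ∨ (∃ i ≤ s, w = g i) ∨ ∃ j ≤ N, w = A j) → G.Adj (A j) w →
          w = a ∨ w = b ∨ w = c := by
      intro c hc
      refine ⟨A (j - 1), A (j + 1), c, ?_⟩
      rintro w (hw | hw | ⟨j', hj', rfl⟩) hadj
      · exact Or.inr (Or.inr (hc w (Or.inl hw) hadj))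
      · exact Or.inr (Or.inr (hc w (Or.inr hw) hadj))
      · rw [hA.adj_iff' hj hj'] at hadj
        rcases hadj with rfl | rfl <;> simp
    by_cases hx : j = α₁ ∨ j = α₂
    · by_cases hb : j = β₁ ∨ j = β₂
      · have hjN : j = 0 ∨ j = N := by omega
        refine ⟨A (if j = 0 then 1 else j - 1), x, g s, ?_⟩
        rintro w (rfl | ⟨i', hi', rfl⟩ | ⟨j', hj', rfl⟩) hw
        · simp
        · rcases hgj i' hi' hw with rfl | ⟨rfl, h3, h4⟩
          · simp
          · omega
        · rw [hA.adj_iff' hj hj'] at hw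
          left
          congr 1
          split_ifs <;> omega
      · refine main x ?_
        rintro w (rfl | ⟨i, hi, rfl⟩) hw
        · rfl
        · rcases hgj i hi hw with rfl | ⟨rfl, h3, h4⟩
          · exact absurd ((avA j hj).mp hw.symm) hb
          · omega
    · by_cases hN : j = N ∧ α₂ < N
      · refine ⟨A (j - 1), g 0, g s, ?_⟩
        rintro w (rfl | ⟨i', hi', rfl⟩ | ⟨j', hj', rfl⟩) hw
        · exact absurd ((axA j hj).mp hw.symm) hx
        · rcases hgj i' hi' hw with rfl | ⟨rfl, h3, h4⟩ <;> simp
        · rw [hA.adj_iff' hj hj'] at hw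
          rw [show j' = j - 1 by omega]
          simp
      · refine main (g s) ?_
        rintro w (rfl | ⟨i, hi, rfl⟩) hw
        · exact absurd ((axA j hj).mp hw.symm) hx
        · rcases hgj i hi hw with rfl | ⟨rfl, h3, h4⟩
          · rfl
          · exact absurd ⟨h3, h4⟩ hN

end Certificates

end SimpleGraph

/-! ### Wheels with a marked sector, tails, and the forbidden attachments of an outside vertex. -/

namespace SimpleGraph

section Frames

variable {V : Type*} {G : SimpleGraph V}

/-- A wheel with hole `h` and center `x`, whose first four spokes end in
`h 0`, `h a`, `h b` and `h c`. -/
structure IsFrame (G : SimpleGraph V) (x : V) (h : ℕ → V) (n a b c : ℕ) : Prop where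
  hole : G.IsHole h n
  ne : ∀ k < n, h k ≠ x
  two_le : 2 ≤ a
  hab : a + 2 ≤ b
  hbc : b + 2 ≤ c
  hcn : c + 2 ≤ n
  adj_iff : ∀ k ≤ c, G.Adj x (h k) ↔ k = 0 ∨ k = a ∨ k = b ∨ k = c

/-- The vertices other than `x`, not adjacent to `x`, that lie strictly between `h b` and `h c` or
outside of the hole, and whose neighbours on the hole are between `h b` and `h c`. -/
def inner (G : SimpleGraph V) (x : V) (h : ℕ → V) (n b c : ℕ) : Set V :=
  {y | y ≠ x ∧ ¬ G.Adj x y ∧ (∀ j < n, y = h j → b < j ∧ j < c) ∧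
    ∀ j < n, G.Adj y (h j) → b ≤ j ∧ j ≤ c}

/-- A vertex outside of the wheel that is not adjacent to the center. -/
structure IsOutside (G : SimpleGraph V) (x : V) (h : ℕ → V) (n : ℕ) (v : V) : Prop where
  ne : v ≠ x
  not_adj : ¬ G.Adj x v
  ne_hole : ∀ j < n, v ≠ h j

/-- An induced path from `h e` to `v` through inner vertices. -/
structure IsTail (G : SimpleGraph V) (x : V) (h : ℕ → V) (n b c e : ℕ) (g : ℕ → V) (s : ℕ)
    (v : V) : Prop where
  path : G.IsInducedPath g s
  zero : g 0 = h e
  last : g s = v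
  mid : ∀ i, 0 < i → i < s → g i ∈ inner G x h n b c

variable {x v : V} {h g : ℕ → V} {n a b c e s : ℕ}

lemma IsTail.one_le (ht : G.IsTail x h n b c e g s v) (hv : G.IsOutside x h n v) (he : e < n) :
    1 ≤ s := by
  by_contra hs
  obtain rfl : s = 0 := by omega
  exact hv.ne_hole e he (ht.last.symm.trans ht.zero)

lemma IsTail.cases (ht : G.IsTail x h n b c e g s v) {i : ℕ} (hi : i ≤ s) :
    (i = 0 ∧ g i = h e) ∨ (i = s ∧ g i = v) ∨ (0 < i ∧ i < s ∧ g i ∈ inner G x h n b c) := by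
  by_cases h0 : i = 0
  · subst h0; exact Or.inl ⟨rfl, ht.zero⟩
  by_cases hs : i = s
  · subst hs; exact Or.inr (Or.inl ⟨rfl, ht.last⟩)
  · exact Or.inr (Or.inr ⟨by omega, by omega, ht.mid i (by omega) (by omega)⟩)

lemma IsTail.adj_center_iff (ht : G.IsTail x h n b c e g s v) (hv : G.IsOutside x h n v)
    (he : e < n) (hxe : G.Adj x (h e)) {i : ℕ} (hi : i ≤ s) : G.Adj x (g i) ↔ i = 0 := by
  have hs := ht.one_le hv he
  rcases ht.cases hi with ⟨rfl, h1⟩ | ⟨rfl, h1⟩ | ⟨h0, -, h1⟩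
  · rw [h1]; simpa using hxe
  · rw [h1]
    exact ⟨fun h2 => absurd h2 hv.not_adj, fun h2 => by omega⟩
  · exact ⟨fun h2 => absurd h2 h1.2.1, fun h2 => by omega⟩

lemma IsTail.ne_center (ht : G.IsTail x h n b c e g s v) (hv : G.IsOutside x h n v)
    (hxe : G.Adj x (h e)) {i : ℕ} (hi : i ≤ s) : g i ≠ x := by
  rcases ht.cases hi with ⟨-, h1⟩ | ⟨-, h1⟩ | ⟨-, -, h1⟩
  · rw [h1]; exact hxe.ne.symm
  · rw [h1]; exact hv.ne
  · exact h1.1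

lemma IsTail.eq_hole (ht : G.IsTail x h n b c e g s v) (hv : G.IsOutside x h n v)
    (hh : G.IsHole h n) (he : e < n) {i j : ℕ} (hi : i ≤ s) (hj : j < n) (hij : g i = h j) :
    (i = 0 ∧ j = e) ∨ (b < j ∧ j < c) := by
  rcases ht.cases hi with ⟨h0, h1⟩ | ⟨-, h1⟩ | ⟨-, -, h1⟩
  · exact Or.inl ⟨h0, hh.inj hj he (hij.symm.trans h1)⟩
  · exact absurd (h1.symm.trans hij) (hv.ne_hole j hj)
  · exact Or.inr (h1.2.2.1 j hj hij)

/-- Nested feet on the first sector: `x` is attached at its ends and `v` at its two feet, while the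
tail from the spoke end `h b` links `x` with `v`. -/
lemma IsFrame.false_of_two_feet [Finite V] (hfree : G.ISK4Free) (hg : 5 ≤ G.egirth)
    (F : G.IsFrame x h n a b c) (hv : G.IsOutside x h n v) (ht : G.IsTail x h n b c b g s v)
    {i₁ i₂ : ℕ} (h12 : i₁ < i₂) (h2a : i₂ ≤ a)
    (hadj : ∀ j ≤ a, G.Adj v (h j) ↔ j = i₁ ∨ j = i₂) : False := by
  have h1 := F.two_le
  have h2 := F.hab
  have h3 := F.hbc
  have h4 := F.hcn
  have hxb : G.Adj x (h b) := (F.adj_iff b (by omega)).mpr (by omega)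
  refine false_of_nested_feet hfree hg (F.hole.isInducedPath (N := a) (by omega)) ht.path
    (ht.one_le hv (by omega)) (α₁ := 0) (α₂ := a) (β₁ := i₁) (β₂ := i₂) (k := i₁) (x := x)
    ?_ (fun j hj => F.ne j (by omega)) (fun i hi => ht.ne_center hv hxb hi) ?_
    (fun i hi => ht.adj_center_iff hv (by omega) hxb hi)
    (by rwa [ht.last]) ?_ ?_ (by omega) (by omega) (by omega) (by omega) (by omega) (by omega)
    (by omega) (by omega)
  · intro i hi j hj he
    have := ht.eq_hole hv F.hole (by omega) hi (by omega) he
    omega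
  · intro j hj
    rw [F.adj_iff j (by omega)]
    omega
  · intro i hi his j hj hij
    have := (ht.mid i hi his).2.2.2 j (by omega) hij
    omega
  · intro j hj hij
    rw [ht.zero, F.hole.adj_iff' (by omega) (by omega)] at hij
    omega

/-- The branch vertices of the subdivision are `x`, `h z`, `h a` and `h b`; the tail through `v`
joins `h z` to `h b`, and `h 0` lies between `x` and `h z`. -/
lemma IsFrame.false_of_one_foot [Finite V] (hfree : G.ISK4Free) (hg : 5 ≤ G.egirth)
    (F : G.IsFrame x h n a b c) (hv : G.IsOutside x h n v) (ht : G.IsTail x h n b c b g s v)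
    {z : ℕ} (hz : 0 < z) (hza : z < a) (hadj : ∀ j < b, G.Adj v (h j) ↔ j = z) : False := by
  have h1 := F.two_le
  have h2 := F.hab
  have h3 := F.hbc
  have h4 := F.hcn
  have hs := ht.one_le hv (by omega)
  have hxb : G.Adj x (h b) := (F.adj_iff b (by omega)).mpr (by omega)
  have hx0 : G.Adj x (h 0) := (F.adj_iff 0 (by omega)).mpr (by omega)
  have hxa : G.Adj x (h a) := (F.adj_iff a (by omega)).mpr (by omega)
  have hvz : G.Adj v (h z) := (hadj z (by omega)).mpr rfl
  have cA : ∀ p q, p < q → q ≤ b → (G.induce (arc h p q)).Connected := fun p q hpq hq =>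
    connected_induce_arc hpq fun k _ hk => F.hole.adj_succ (by omega)
  have cg : (G.induce (arc g 0 (s + 1))).Connected :=
    connected_induce_arc (by omega) fun k _ hk =>
      (ht.path.adj_iff k (k + 1) (by omega) (by omega)).mpr rfl
  have dxh : ∀ p q, q ≤ b → x ∉ arc h p q := by
    rintro p q hq ⟨k, hk1, hk2, he⟩
    exact F.ne k (by omega) he
  have dhh : ∀ p q r t, q ≤ r → t ≤ b → ∀ v ∈ arc h p q, v ∉ arc h r t := by
    rintro p q r t hqr ht v ⟨k, hk1, hk2, rfl⟩ ⟨k', hk1', hk2', he⟩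
    have := F.hole.inj (by omega) (by omega) he
    omega
  have dhg : ∀ p q, q ≤ b → ∀ v ∈ arc h p q, v ∉ arc g 0 (s + 1) := by
    rintro p q hq v ⟨k, hk1, hk2, rfl⟩ ⟨i, hi1, hi2, he⟩
    have := ht.eq_hole hv F.hole (by omega) (by omega) (by omega) he
    omega
  have hminor := hasK4Minor_of_sets (G := G) ({x} ∪ arc h 0 z) (arc h z a) (arc h a b)
    (arc g 0 (s + 1))
    (connected_induce_union_of_adj (connected_induce_singleton x) (cA _ _ hz (by omega))
      ⟨x, rfl, h 0, mem_arc le_rfl hz, hx0⟩)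
    (cA _ _ hza (by omega)) (cA _ _ (by omega) le_rfl) cg
    (by
      rintro v (rfl | hv)
      · exact dxh _ _ (by omega)
      · exact dhh _ _ _ _ le_rfl (by omega) v hv)
    (by
      rintro v (rfl | hv)
      · exact dxh _ _ (by omega)
      · exact dhh _ _ _ _ (by omega) (by omega) v hv)
    (by
      rintro v (rfl | hv)
      · rintro ⟨i, -, hi, he⟩
        exact ht.ne_center hv hxb (by omega) he
      · exact dhg _ _ (by omega) v hv)
    (dhh _ _ _ _ le_rfl le_rfl) (dhg _ _ (by omega)) (dhg _ _ le_rfl)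
    ⟨h (z - 1), Or.inr (mem_arc (by omega) (by omega)), h z, mem_arc le_rfl hza,
      (F.hole.adj_iff _ _ (by omega) (by omega)).mpr (by omega)⟩
    ⟨x, Or.inl rfl, h a, mem_arc le_rfl (by omega), hxa⟩
    ⟨x, Or.inl rfl, g 0, mem_arc le_rfl (by omega), by rwa [ht.zero]⟩
    ⟨h (a - 1), mem_arc (by omega) (by omega), h a, mem_arc le_rfl (by omega),
      (F.hole.adj_iff _ _ (by omega) (by omega)).mpr (by omega)⟩
    ⟨h z, mem_arc le_rfl hza, g s, mem_arc (by omega) (by omega), by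
      rw [ht.last]; exact hvz.symm⟩
    ⟨h (b - 1), mem_arc (by omega) (by omega), g 0, mem_arc le_rfl (by omega), by
      rw [ht.zero]; exact (F.hole.adj_iff _ _ (by omega) (by omega)).mpr (by omega)⟩
  have hmem : ∀ w ∈ ((({x} ∪ arc h 0 z) ∪ arc h z a ∪ arc h a b ∪ arc g 0 (s + 1)) : Set V),
      w = x ∨ (∃ j < b, w = h j) ∨ ∃ i ≤ s, w = g i := by
    rintro w ((((rfl | ⟨j, -, hj, rfl⟩) | ⟨j, -, hj, rfl⟩) | ⟨j, -, hj, rfl⟩) | ⟨i, -, hi, rfl⟩)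
    · exact Or.inl rfl
    · exact Or.inr (Or.inl ⟨j, by omega, rfl⟩)
    · exact Or.inr (Or.inl ⟨j, by omega, rfl⟩)
    · exact Or.inr (Or.inl ⟨j, by omega, rfl⟩)
    · exact Or.inr (Or.inr ⟨i, by omega, rfl⟩)
  refine false_of_hasK4Minor_of_degree_le_three hfree hg hminor fun u hu => ?_
  suffices hsuf : ∃ p q r, ∀ w, (w = x ∨ (∃ j < b, w = h j) ∨ ∃ i ≤ s, w = g i) → G.Adj u w →
      w = p ∨ w = q ∨ w = r by
    obtain ⟨p, q, r, hpqr⟩ := hsuf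
    exact ⟨p, q, r, fun w hw => hpqr w (hmem w hw)⟩
  have hhg : ∀ j < b, ∀ i ≤ s, G.Adj (h j) (g i) → (i = 0 ∧ j = b - 1) ∨ (i = s ∧ j = z) := by
    intro j hj i hi hij
    rcases ht.cases hi with ⟨rfl, h5⟩ | ⟨rfl, h5⟩ | ⟨-, -, h5⟩
    · rw [h5, F.hole.adj_iff' (by omega) (by omega)] at hij
      omega
    · rw [h5] at hij
      exact Or.inr ⟨rfl, (hadj j hj).mp hij.symm⟩
    · have := h5.2.2.2 j (by omega) hij.symm
      omega
  rcases hmem u hu with rfl | ⟨j, hj, rfl⟩ | ⟨i, hi, rfl⟩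
  · refine ⟨h 0, h a, g 0, ?_⟩
    rintro w (rfl | ⟨j, hj, rfl⟩ | ⟨i, hi, rfl⟩) hw
    · exact absurd hw G.irrefl
    · rw [F.adj_iff j (by omega)] at hw
      rcases hw with rfl | rfl | rfl | rfl <;> first | omega | simp
    · rw [(ht.adj_center_iff hv (by omega) hxb hi).mp hw]; simp
  · by_cases hjz : j = z
    · refine ⟨h (j - 1), h (j + 1), v, ?_⟩
      rintro w (rfl | ⟨j', hj', rfl⟩ | ⟨i, hi, rfl⟩) hw
      · have := (F.adj_iff j (by omega)).mp hw.symm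
        omega
      · rw [F.hole.adj_iff' (by omega) (by omega)] at hw
        rcases hw with rfl | rfl | hw | hw <;> first | omega | simp
      · rcases hhg j hj i hi hw with h5 | ⟨rfl, -⟩
        · omega
        · rw [ht.last]; simp
    · refine ⟨h (j - 1), h (j + 1), x, ?_⟩
      rintro w (rfl | ⟨j', hj', rfl⟩ | ⟨i, hi, rfl⟩) hw
      · simp
      · rw [F.hole.adj_iff' (by omega) (by omega)] at hw
        rcases hw with rfl | rfl | hw | hw <;> first | omega | simp
      · rcases hhg j hj i hi hw with ⟨rfl, rfl⟩ | h5
        · rw [ht.zero, Nat.sub_add_cancel (by omega)]; simp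
        · omega
  · by_cases hi0 : i = 0
    · subst hi0
      refine ⟨x, h (b - 1), g 1, ?_⟩
      rintro w (rfl | ⟨j, hj, rfl⟩ | ⟨i', hi', rfl⟩) hw
      · simp
      · rcases hhg j hj 0 hi hw.symm with ⟨-, rfl⟩ | h5
        · simp
        · omega
      · rw [ht.path.adj_iff' hi hi'] at hw
        rw [show i' = 1 by omega]; simp
    · refine ⟨g (i - 1), g (i + 1), h z, ?_⟩
      rintro w (rfl | ⟨j, hj, rfl⟩ | ⟨i', hi', rfl⟩) hw
      · exact absurd ((ht.adj_center_iff hv (by omega) hxb hi).mp hw.symm) hi0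
      · rcases hhg j hj i hi hw.symm with h5 | ⟨-, rfl⟩
        · omega
        · simp
      · rw [ht.path.adj_iff' hi hi'] at hw
        rcases hw with rfl | rfl <;> simp

/-- Here no tail is needed: the hole between `h q` and `h b` leads from `v` to `x`. The branch
vertices are `x`, `h z`, `h a` and `v` if `p < q`; if `p = q`, then `h p` takes the place of `v`.
The hole vertices strictly between `h p` and `h q` are dropped. -/
lemma IsFrame.false_of_one_foot_of_foot [Finite V] (hfree : G.ISK4Free) (hg : 5 ≤ G.egirth)
    (F : G.IsFrame x h n a b c) (hv : G.IsOutside x h n v)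
    {z p q : ℕ} (hz : 0 < z) (hza : z < a) (hap : a < p) (hpb : p < b) (hpq : p ≤ q) (hqb : q ≤ b)
    (hvz : G.Adj v (h z)) (hvp : G.Adj v (h p)) (hvq : G.Adj v (h q))
    (hadj : ∀ j ≤ b, j ≤ p ∨ q ≤ j → G.Adj v (h j) → j = z ∨ j = p ∨ j = q) : False := by
  have h1 := F.two_le
  have h2 := F.hab
  have h3 := F.hbc
  have h4 := F.hcn
  have hx0 : G.Adj x (h 0) := (F.adj_iff 0 (by omega)).mpr (by omega)
  have hxa : G.Adj x (h a) := (F.adj_iff a (by omega)).mpr (by omega)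
  have hxb : G.Adj x (h b) := (F.adj_iff b (by omega)).mpr (by omega)
  have hqp : q ≠ p + 1 := by
    rintro rfl
    exact not_triangle_of_five_le_egirth hg hvp (F.hole.adj_succ (by omega)) hvq.symm
  -- `h k` is the last vertex of the branch set of `h a`. Since `h q` is grouped with `v`, this set
  -- ends at `h p` only if `p < q`.
  obtain ⟨k, hk⟩ : ∃ k, (p < q ∧ k = p) ∨ (p = q ∧ k = q - 1) := by
    rcases hpq.lt_or_eq with h5 | h5
    · exact ⟨p, Or.inl ⟨h5, rfl⟩⟩
    · exact ⟨q - 1, Or.inr ⟨h5, rfl⟩⟩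
  have cA : ∀ p q, p < q → q ≤ b + 1 → (G.induce (arc h p q)).Connected := fun p q hpq hq =>
    connected_induce_arc hpq fun k _ hk => F.hole.adj_succ (by omega)
  have dxh : ∀ p q, q ≤ b + 1 → x ∉ arc h p q := by
    rintro p q hq ⟨k, hk1, hk2, he⟩
    exact F.ne k (by omega) he
  have dvh : ∀ p q, q ≤ b + 1 → v ∉ arc h p q := by
    rintro p q hq ⟨k, hk1, hk2, he⟩
    exact hv.ne_hole k (by omega) he.symm
  have dhh : ∀ p q r t, q ≤ r ∨ t ≤ p → q ≤ b + 1 → t ≤ b + 1 →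
      ∀ v ∈ arc h p q, v ∉ arc h r t := by
    rintro p q r t hqr hq ht v ⟨k, hk1, hk2, rfl⟩ ⟨k', hk1', hk2', he⟩
    have := F.hole.inj (by omega) (by omega) he
    omega
  have cX : (G.induce ({x} ∪ arc h 0 z)).Connected :=
    connected_induce_union_of_adj (connected_induce_singleton x) (cA _ _ hz (by omega))
      ⟨x, rfl, h 0, mem_arc le_rfl hz, hx0⟩
  have cX' : (G.induce ({x} ∪ arc h 0 z ∪ arc h (q + 1) (b + 1))).Connected := by
    rcases hqb.lt_or_eq with h5 | rfl
    · exact connected_induce_union_of_adj cX (cA _ _ (by omega) le_rfl)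
        ⟨x, Or.inl rfl, h b, mem_arc (by omega) (by omega), hxb⟩
    · have : arc h (q + 1) (q + 1) = ∅ := by
        ext v
        simp only [arc, Set.mem_ofPred_eq, Set.mem_empty_iff_false, iff_false]
        rintro ⟨k, h5, h6, -⟩
        omega
      rwa [this, Set.union_empty]
  have hminor := hasK4Minor_of_sets (G := G) ({x} ∪ arc h 0 z ∪ arc h (q + 1) (b + 1))
    (arc h z a) (arc h a (k + 1)) ({v} ∪ arc h q (q + 1)) cX'
    (cA _ _ hza (by omega)) (cA _ _ (by omega) (by omega))
    (connected_induce_union_of_adj (connected_induce_singleton v) (cA _ _ (by omega) (by omega))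
      ⟨v, rfl, h q, mem_arc le_rfl (by omega), hvq⟩)
    (by
      rintro v ((rfl | hv) | hv)
      · exact dxh _ _ (by omega)
      · exact dhh _ _ _ _ (by omega) (by omega) (by omega) v hv
      · exact dhh _ _ _ _ (by omega) (by omega) (by omega) v hv)
    (by
      rintro v ((rfl | hv) | hv)
      · exact dxh _ _ (by omega)
      · exact dhh _ _ _ _ (by omega) (by omega) (by omega) v hv
      · exact dhh _ _ _ _ (by omega) (by omega) (by omega) v hv)
    (by
      rintro u ((rfl | hu) | hu) (rfl | hu')
      · exact hv.ne rfl
      · exact dxh _ _ (by omega) hu'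
      · exact dvh _ _ (by omega) hu
      · exact dhh _ _ _ _ (by omega) (by omega) (by omega) u hu hu'
      · exact dvh _ _ (by omega) hu
      · exact dhh _ _ _ _ (by omega) (by omega) (by omega) u hu hu')
    (dhh _ _ _ _ (by omega) (by omega) (by omega))
    (by
      rintro u hu (rfl | hu')
      · exact dvh _ _ (by omega) hu
      · exact dhh _ _ _ _ (by omega) (by omega) (by omega) u hu hu')
    (by
      rintro u hu (rfl | hu')
      · exact dvh _ _ (by omega) hu
      · exact dhh _ _ _ _ (by omega) (by omega) (by omega) u hu hu')
    ⟨h (z - 1), Or.inl (Or.inr (mem_arc (by omega) (by omega))), h z, mem_arc le_rfl hza,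
      (F.hole.adj_iff _ _ (by omega) (by omega)).mpr (by omega)⟩
    ⟨x, Or.inl (Or.inl rfl), h a, mem_arc le_rfl (by omega), hxa⟩
    (by
      rcases hqb.lt_or_eq with h5 | rfl
      · exact ⟨h (q + 1), Or.inr (mem_arc le_rfl (by omega)), h q,
          Or.inr (mem_arc le_rfl (by omega)), (F.hole.adj_succ (by omega)).symm⟩
      · exact ⟨x, Or.inl (Or.inl rfl), h q, Or.inr (mem_arc le_rfl (by omega)), hxb⟩)
    ⟨h (a - 1), mem_arc (by omega) (by omega), h a, mem_arc le_rfl (by omega),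
      (F.hole.adj_iff _ _ (by omega) (by omega)).mpr (by omega)⟩
    ⟨h z, mem_arc le_rfl hza, v, Or.inl rfl, hvz.symm⟩
    (by
      rcases hk with ⟨h5, rfl⟩ | ⟨rfl, rfl⟩
      · exact ⟨h k, mem_arc (by omega) (by omega), v, Or.inl rfl, hvp.symm⟩
      · exact ⟨h (p - 1), mem_arc (by omega) (by omega), h p, Or.inr (mem_arc le_rfl (by omega)),
          (F.hole.adj_iff _ _ (by omega) (by omega)).mpr (by omega)⟩)
  have hmem : ∀ w ∈ ((({x} ∪ arc h 0 z ∪ arc h (q + 1) (b + 1)) ∪ arc h z a ∪ arc h a (k + 1) ∪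
      ({v} ∪ arc h q (q + 1))) : Set V),
      w = x ∨ w = v ∨ ∃ j ≤ b, (j ≤ p ∨ q ≤ j) ∧ w = h j := by
    rintro w (((((rfl | ⟨j, hj', hj, rfl⟩) | ⟨j, hj', hj, rfl⟩) | ⟨j, hj', hj, rfl⟩) |
      ⟨j, hj', hj, rfl⟩) | (rfl | ⟨j, hj', hj, rfl⟩))
    · exact Or.inl rfl
    · exact Or.inr (Or.inr ⟨j, by omega, by omega, rfl⟩)
    · exact Or.inr (Or.inr ⟨j, by omega, by omega, rfl⟩)
    · exact Or.inr (Or.inr ⟨j, by omega, by omega, rfl⟩)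
    · exact Or.inr (Or.inr ⟨j, by omega, by omega, rfl⟩)
    · exact Or.inr (Or.inl rfl)
    · exact Or.inr (Or.inr ⟨j, by omega, by omega, rfl⟩)
  refine false_of_hasK4Minor_of_degree_le_three hfree hg hminor fun u hu => ?_
  suffices hsuf : ∃ p' q' r, ∀ w, (w = x ∨ w = v ∨ ∃ j ≤ b, (j ≤ p ∨ q ≤ j) ∧ w = h j) →
      G.Adj u w → w = p' ∨ w = q' ∨ w = r by
    obtain ⟨p', q', r, hpqr⟩ := hsuf
    exact ⟨p', q', r, fun w hw => hpqr w (hmem w hw)⟩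
  rcases hmem u hu with rfl | rfl | ⟨j, hj, hjpq, rfl⟩
  · refine ⟨h 0, h a, h b, ?_⟩
    rintro w (rfl | rfl | ⟨j, hj, -, rfl⟩) hw
    · exact absurd hw G.irrefl
    · exact absurd hw hv.not_adj
    · rw [F.adj_iff j (by omega)] at hw
      rcases hw with rfl | rfl | rfl | rfl <;> first | omega | simp
  · refine ⟨h z, h p, h q, ?_⟩
    rintro w (rfl | rfl | ⟨j, hj, hjpq, rfl⟩) hw
    · exact absurd hw.symm hv.not_adj
    · exact absurd hw G.irrefl
    · rcases hadj j hj hjpq hw with rfl | rfl | rfl <;> simp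
  · by_cases hjx : j = 0 ∨ j = a ∨ j = b
    · by_cases hjq : j = q
      · refine ⟨x, v, x, ?_⟩
        rintro w (rfl | rfl | ⟨j', hj', hjpq', rfl⟩) hw
        · simp
        · simp
        · rw [F.hole.adj_iff' (by omega) (by omega)] at hw
          omega
      · refine ⟨h (j - 1), h (j + 1), x, ?_⟩
        rintro w (rfl | rfl | ⟨j', hj', hjpq', rfl⟩) hw
        · simp
        · have := hadj j hj hjpq hw.symm
          omega
        · rw [F.hole.adj_iff' (by omega) (by omega)] at hw
          rcases hw with rfl | rfl | hw | hw <;> first | omega | simp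
    · refine ⟨h (j - 1), h (j + 1), v, ?_⟩
      rintro w (rfl | rfl | ⟨j', hj', hjpq', rfl⟩) hw
      · have := (F.adj_iff j (by omega)).mp hw.symm
        omega
      · simp
      · rw [F.hole.adj_iff' (by omega) (by omega)] at hw
        rcases hw with rfl | rfl | hw | hw <;> first | omega | simp

/-- Nested feet on the path `h w, …, h (n - 1), h 0, …, h p`: `v` is attached at its ends and `x` at
`h 0` and `h a`. If `p + 1 = b`, the start `h b` of the tail is also adjacent to the last vertex `h
p`. -/
lemma IsFrame.false_of_feet_both_sides [Finite V] (hfree : G.ISK4Free) (hg : 5 ≤ G.egirth)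
    (F : G.IsFrame x h n a b c) (hv : G.IsOutside x h n v) (ht : G.IsTail x h n b c b g s v)
    {p w : ℕ} (hap : a ≤ p) (hpb : p < b) (hcw : c < w) (hwn : w ≤ n)
    (hadj : ∀ j < n, j ≤ p ∨ w ≤ j → (G.Adj v (h j) ↔ j = p ∨ j = w ∨ (w = n ∧ j = 0)))
    (hxw : ∀ j < n, w ≤ j → ¬ G.Adj x (h j)) : False := by
  have h1 := F.two_le
  have h2 := F.hab
  have h3 := F.hbc
  have h4 := F.hcn
  have hxb : G.Adj x (h b) := (F.adj_iff b (by omega)).mpr (by omega)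
  -- The path starts at `h w` and passes position `0` after `n - w` steps; `w = n` means that it
  -- starts at `h 0`.
  set A : ℕ → V := fun j => h (if j < n - w then w + j else j - (n - w)) with hA
  have hidx : ∀ j ≤ n - w + p, ∃ i < n, A j = h i ∧
      ((j < n - w ∧ i = w + j) ∨ (n - w ≤ j ∧ i = j - (n - w))) := by
    intro j hj
    refine ⟨if j < n - w then w + j else j - (n - w), ?_, rfl, ?_⟩ <;> split_ifs <;> omega
  refine false_of_nested_feet hfree hg (A := A) (N := n - w + p) (s := s) (g := g) (x := x)
    (α₁ := n - w) (α₂ := n - w + a) (β₁ := 0) (β₂ := n - w + p) (k := n - w) ⟨?_, ?_⟩ ht.path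
    (ht.one_le hv (by omega)) ?_ ?_ (fun i hi => ht.ne_center hv hxb hi) ?_
    (fun i hi => ht.adj_center_iff hv (by omega) hxb hi) ?_ ?_ ?_ (by omega) (by omega) (by omega)
    (by omega) (by omega) (by omega) (by omega) (by omega)
  · intro i j hij hj he
    obtain ⟨i', hi', e1, h5⟩ := hidx i (by omega)
    obtain ⟨j', hj', e2, h6⟩ := hidx j hj
    rw [e1, e2] at he
    have := F.hole.inj hi' hj' he
    omega
  · intro i j hij hj
    obtain ⟨i', hi', e1, h5⟩ := hidx i (by omega)
    obtain ⟨j', hj', e2, h6⟩ := hidx j hj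
    rw [e1, e2, F.hole.adj_iff' hi' hj']
    omega
  · intro i hi j hj he
    obtain ⟨j', hj', e2, h6⟩ := hidx j hj
    rw [e2] at he
    have := ht.eq_hole hv F.hole (by omega) hi hj' he
    omega
  · intro j hj
    obtain ⟨j', hj', e2, h6⟩ := hidx j hj
    rw [e2]
    exact F.ne j' hj'
  · intro j hj
    obtain ⟨j', hj', e2, h6⟩ := hidx j hj
    rw [e2]
    rcases h6 with h6 | h6
    · refine ⟨fun h7 => absurd h7 (hxw j' hj' (by omega)), by omega⟩
    · rw [F.adj_iff j' (by omega)]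
      omega
  · intro j hj
    obtain ⟨j', hj', e2, h6⟩ := hidx j hj
    rw [e2, ht.last, hadj j' hj' (by omega)]
    omega
  · intro i hi his j hj hij
    obtain ⟨j', hj', e2, h6⟩ := hidx j hj
    rw [e2] at hij
    have := (ht.mid i hi his).2.2.2 j' hj' hij
    omega
  · intro j hj hij
    obtain ⟨j', hj', e2, h6⟩ := hidx j hj
    rw [e2, ht.zero, F.hole.adj_iff' (by omega) hj'] at hij
    omega

end Frames

end SimpleGraph

/-! ### Wheels with the fewest spokes and the star cutset. -/

namespace SimpleGraph

section Main

variable {V : Type*} {G : SimpleGraph V}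

/-- The ends on the hole of the spokes of a wheel. -/
def spokes (G : SimpleGraph V) (x : V) (h : ℕ → V) (n : ℕ) : Set V :=
  {v | G.Adj x v ∧ ∃ k < n, h k = v}

/-- Among the wheels with center `x` that share the sector `h 0, …, h a`, the given one has the
fewest spokes. -/
def HasFewestSpokes (G : SimpleGraph V) (x : V) (h : ℕ → V) (n a : ℕ) : Prop :=
  ∀ h' n', G.IsHole h' n' → (∀ k < n', h' k ≠ x) → (∀ k ≤ a, h' k = h k) → a < n' →
    (∃ e, a < e ∧ e < n' ∧ G.Adj x (h' e)) → (spokes G x h n).ncard ≤ (spokes G x h' n').ncard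

variable {x v : V} {h g : ℕ → V} {n a b c s : ℕ}

/-- The rerouted hole keeps the first sector and, by `hthird`, a third spoke, so it competes for the
minimum. By `hgs` it gains no spoke end, and it loses `h e`. -/
lemma HasFewestSpokes.false_of_splice [Finite V] (hmin : HasFewestSpokes G x h n a)
    (hh : G.IsHole h n) (hx : ∀ k < n, h k ≠ x) {q w e : ℕ} (ha : 2 ≤ a) (haq : a ≤ q)
    (hqe : q < e) (hew : e < w) (hw : w ≤ n) (hxe : G.Adj x (h e))
    (hg : G.IsInducedPath g s) (hd : ∀ i ≤ s, ∀ j < n, j ≤ q ∨ w ≤ j → g i ≠ h j)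
    (hadj : ∀ i ≤ s, ∀ j < n, j ≤ q ∨ w ≤ j → (G.Adj (g i) (h j) ↔
      (i = 0 ∧ j = q) ∨ (i = s ∧ (j = w ∨ (w = n ∧ j = 0)))))
    (hgx : ∀ i ≤ s, g i ≠ x) (hge : ∀ i ≤ s, g i ≠ h e)
    (hgs : ∀ i ≤ s, G.Adj x (g i) → ∃ j < n, g i = h j)
    (hthird : (∃ i ≤ s, G.Adj x (g i)) ∨ ∃ j < n, w ≤ j ∧ G.Adj x (h j)) : False := by
  have hcase : ∀ k < q + s + 2 + (n - w), (k ≤ q ∧ splice h g q s w k = h k) ∨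
      (∃ i ≤ s, k = q + 1 + i ∧ splice h g q s w k = g i) ∨
      ∃ j < n, w ≤ j ∧ k = q + s + 2 + (j - w) ∧ splice h g q s w k = h j := by
    intro k hk
    unfold splice
    split_ifs with h1 h2
    · exact Or.inl ⟨h1, rfl⟩
    · exact Or.inr (Or.inl ⟨_, by omega, by omega, rfl⟩)
    · exact Or.inr (Or.inr ⟨_, by omega, by omega, by omega, rfl⟩)
  have hle := hmin (splice h g q s w) (q + s + 2 + (n - w))
    (hh.splice (by omega) hw hg hd hadj (by omega)) ?_ ?_ (by omega) ?_
  · refine absurd hle (not_le.mpr (Set.ncard_lt_ncard ⟨?_, fun hsub => ?_⟩ (Set.toFinite _)))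
    · rintro u ⟨hxu, k, hk, rfl⟩
      refine ⟨hxu, ?_⟩
      rcases hcase k hk with ⟨h1, h2⟩ | ⟨i, hi, h1, h2⟩ | ⟨j, hj, h1, h3, h2⟩
      · exact ⟨k, by omega, h2.symm⟩
      · rw [h2] at hxu ⊢
        obtain ⟨j, hj, h3⟩ := hgs i hi hxu
        exact ⟨j, hj, h3.symm⟩
      · exact ⟨j, hj, h2.symm⟩
    · obtain ⟨-, k, hk, hke⟩ := hsub ⟨hxe, e, by omega, rfl⟩
      rcases hcase k hk with ⟨h1, h2⟩ | ⟨i, hi, h1, h2⟩ | ⟨j, hj, h1, h3, h2⟩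
      · have := hh.inj (by omega) (by omega) (h2.symm.trans hke)
        omega
      · exact hge i hi (h2.symm.trans hke)
      · have := hh.inj (by omega) (by omega) (h2.symm.trans hke)
        omega
  · intro k hk
    rcases hcase k hk with ⟨h1, h2⟩ | ⟨i, hi, h1, h2⟩ | ⟨j, hj, h1, h3, h2⟩ <;> rw [h2]
    · exact hx k (by omega)
    · exact hgx i hi
    · exact hx j hj
  · intro k hk
    simp [splice, hk.trans haq]
  · rcases hthird with ⟨i, hi, h1⟩ | ⟨j, hj, h1, h2⟩
    · refine ⟨q + 1 + i, by omega, by omega, ?_⟩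
      rwa [splice, if_neg (by omega), if_pos (by omega), Nat.add_sub_cancel_left]
    · refine ⟨q + s + 2 + (j - w), by omega, by omega, ?_⟩
      rwa [splice, if_neg (by omega), if_neg (by omega), Nat.add_sub_cancel_left,
        Nat.sub_add_cancel h1]

lemma exists_isGreatest_of_le {P : ℕ → Prop} {N k : ℕ} (hk : P k) (hkN : k ≤ N) :
    ∃ m, P m ∧ m ≤ N ∧ ∀ j ≤ N, P j → j ≤ m := by
  classical
  exact ⟨Nat.findGreatest P N, Nat.findGreatest_spec hkN hk, Nat.findGreatest_le N,
    fun j hj hP => Nat.le_findGreatest hj hP⟩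

lemma exists_isLeast_of_pred {P : ℕ → Prop} {k : ℕ} (hk : P k) : ∃ m, P m ∧ ∀ j, P j → m ≤ j := by
  classical
  exact ⟨Nat.find ⟨k, hk⟩, Nat.find_spec ⟨k, hk⟩, fun j hj => Nat.find_min' _ hj⟩

/-- A vertex outside of the wheel, joined by tails to both ends of the sector from `h b` to `h c`,
has no neighbour on the hole outside of this sector. -/
lemma IsFrame.false_of_tails [Finite V] (hfree : G.ISK4Free) (hg : 5 ≤ G.egirth)
    (F : G.IsFrame x h n a b c) (hmin : HasFewestSpokes G x h n a)
    (hthin : ∀ i₁ i₂ i₃, i₁ < i₂ → i₂ < i₃ → i₃ ≤ a → G.Adj v (h i₁) → G.Adj v (h i₂) →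
      G.Adj v (h i₃) → False)
    (hv : G.IsOutside x h n v) (ht : G.IsTail x h n b c b g s v) {g' : ℕ → V} {s' : ℕ}
    (ht' : G.IsTail x h n b c c g' s' v) {j₀ : ℕ} (hj₀ : j₀ < n) (hvj : G.Adj v (h j₀))
    (hj₀' : j₀ < b ∨ c < j₀) : False := by
  have h1 := F.two_le
  have h2 := F.hab
  have h3 := F.hbc
  have h4 := F.hcn
  have hxb : G.Adj x (h b) := (F.adj_iff b (by omega)).mpr (by omega)
  have hxc : G.Adj x (h c) := (F.adj_iff c (by omega)).mpr (by omega)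
  have hs := ht.one_le hv (by omega)
  have hs' := ht'.one_le hv (by omega)
  -- If `v` has a neighbour inside the first sector, a subdivision is found directly; otherwise
  -- rerouting the hole keeps that sector.
  by_cases hγ : ∃ z, 0 < z ∧ z < a ∧ G.Adj v (h z)
  · obtain ⟨z, hz, hza, hvz⟩ := hγ
    by_cases h2f : ∃ z' ≤ a, z' ≠ z ∧ G.Adj v (h z')
    · obtain ⟨z', hz', hne, hvz'⟩ := h2f
      -- As the sector is thin, two neighbours of `v` on it are all of them.
      have key : ∀ i₁ i₂, i₁ < i₂ → i₂ ≤ a → G.Adj v (h i₁) → G.Adj v (h i₂) → False := by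
        intro i₁ i₂ h12 hi ha1 ha2
        refine F.false_of_two_feet hfree hg hv ht h12 hi fun j hj => ⟨fun hvj => ?_, ?_⟩
        · by_contra hne
          rcases Nat.lt_trichotomy j i₁ with h5 | h5 | h5
          · exact hthin j i₁ i₂ h5 h12 hi hvj ha1 ha2
          · omega
          rcases Nat.lt_trichotomy j i₂ with h6 | h6 | h6
          · exact hthin i₁ j i₂ h5 h6 hi ha1 hvj ha2
          · omega
          · exact hthin i₁ i₂ j h12 h6 hj ha1 ha2 hvj
        · rintro (rfl | rfl) <;> assumption
      rcases lt_or_gt_of_ne hne with h5 | h5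
      · exact key z' z h5 hza.le hvz' hvz
      · exact key z z' h5 hz' hvz hvz'
    have hone : ∀ j ≤ a, G.Adj v (h j) → j = z := fun j hj hvj => by
      by_contra hne
      exact h2f ⟨j, hj, hne, hvj⟩
    by_cases hL : ∃ j, a < j ∧ j < b ∧ G.Adj v (h j)
    · obtain ⟨j, hj⟩ := hL
      obtain ⟨p, ⟨hap, hpb, hvp⟩, hpmin⟩ :=
        exists_isLeast_of_pred (P := fun j => a < j ∧ j < b ∧ G.Adj v (h j)) hj
      obtain ⟨q, ⟨haq, hvq⟩, hqb, hqmax⟩ := exists_isGreatest_of_le (N := b)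
        (P := fun j => a < j ∧ G.Adj v (h j)) ⟨hap, hvp⟩ hpb.le
      refine F.false_of_one_foot_of_foot hfree hg hv hz hza hap hpb (hqmax p hpb.le ⟨hap, hvp⟩)
        hqb hvz hvp hvq fun j hj hjpq hvj => ?_
      by_cases hja : j ≤ a
      · exact Or.inl (hone j hja hvj)
      by_cases hjb : j = b
      · have := hqmax j hj ⟨by omega, hvj⟩
        omega
      · have := hqmax j hj ⟨by omega, hvj⟩
        have := hpmin j ⟨by omega, by omega, hvj⟩
        omega
    · refine F.false_of_one_foot hfree hg hv ht hz hza fun j hj => ⟨fun hvj => ?_, ?_⟩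
      · by_cases hja : j ≤ a
        · exact hone j hja hvj
        · exact absurd ⟨j, by omega, hj, hvj⟩ hL
      · rintro rfl; exact hvz
  have hγ' : ∀ j, 0 < j → j < a → ¬ G.Adj v (h j) := fun j h5 h6 h7 => hγ ⟨j, h5, h6, h7⟩
  have tail_adj : ∀ {e g s}, G.IsTail x h n b c e g s v → ∀ i, 0 < i → i < s → ∀ j < n,
      j < b ∨ c < j → ¬ G.Adj (g i) (h j) := by
    intro e g s ht i hi his j hj hjbc hadj
    have := (ht.mid i hi his).2.2.2 j hj hadj
    omega
  have tail_spoke : ∀ {e g s}, G.IsTail x h n b c e g s v → e < n → G.Adj x (h e) → ∀ i ≤ s,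
      G.Adj x (g i) → ∃ j < n, g i = h j := by
    intro e g s ht he hxe i hi hxi
    obtain rfl := (ht.adj_center_iff hv he hxe hi).mp hxi
    exact ⟨e, he, ht.zero⟩
  by_cases hL : ∃ j, a ≤ j ∧ j < b ∧ G.Adj v (h j)
  · obtain ⟨j, hj⟩ := hL
    obtain ⟨p, ⟨hap, hpb, hvp⟩, hpmin⟩ :=
      exists_isLeast_of_pred (P := fun j => a ≤ j ∧ j < b ∧ G.Adj v (h j)) hj
    -- Position `n` is used as a second name of `0`, so that the neighbours of `v` beyond `h c` form
    -- one range.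
    by_cases hR : ∃ j, c < j ∧ j ≤ n ∧ G.Adj v (h (if j = n then 0 else j))
    · obtain ⟨j, hcj, hjn, hvj⟩ := hR
      obtain ⟨w, ⟨hcw, hvw⟩, hwn, hwmax⟩ := exists_isGreatest_of_le (N := n)
        (P := fun j => c < j ∧ G.Adj v (h (if j = n then 0 else j))) ⟨hcj, hvj⟩ hjn
      have hadj : ∀ j < n, j ≤ p ∨ w ≤ j → (G.Adj v (h j) ↔ j = p ∨ j = w ∨ (w = n ∧ j = 0)) := by
        intro j hj hjw
        constructor
        · intro hvj
          rcases hjw with hjp | hjw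
          · by_cases hj0 : j = 0
            · subst hj0
              have := hwmax n le_rfl ⟨by omega, by simpa using hvj⟩
              omega
            · have h5 : a ≤ j := by
                by_contra h5
                exact hγ' j (by omega) (by omega) hvj
              have := hpmin j ⟨h5, by omega, hvj⟩
              omega
          · have := hwmax j hj.le ⟨by omega, by rwa [if_neg (by omega)]⟩
            omega
        · rintro (rfl | rfl | ⟨rfl, rfl⟩)
          · exact hvp
          · rwa [if_neg (by omega)] at hvw
          · rwa [if_pos rfl] at hvw
      by_cases hxw : ∃ j < n, w ≤ j ∧ G.Adj x (h j)
      · refine hmin.false_of_splice (g := fun _ => v) (s := 0) F.hole F.ne h1 hap hpb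
          (show b < w by omega) hwn hxb ⟨by omega, by omega⟩ (fun _ _ j hj _ => hv.ne_hole j hj)
          ?_ (fun _ _ => hv.ne) (fun _ _ => hv.ne_hole b (by omega))
          (fun _ _ h5 => absurd h5 hv.not_adj) (Or.inr hxw)
        intro i hi j hj hjw
        rw [hadj j hj hjw]
        omega
      · exact F.false_of_feet_both_sides hfree hg hv ht hap hpb hcw hwn hadj
          fun j hj hwj hxj => hxw ⟨j, hj, hwj, hxj⟩
    · have hR' : ∀ j < n, c < j ∨ j = 0 → ¬ G.Adj v (h j) := by
        rintro j hj (h5 | rfl) hvj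
        · exact hR ⟨j, h5, hj.le, by rwa [if_neg (by omega)]⟩
        · exact hR ⟨n, by omega, le_rfl, by rwa [if_pos rfl]⟩
      -- The hole passes from `h p` to `v` and along the reversed tail to `h c`; it loses `h b`. As
      -- `h c` is already on the tail, the old hole resumes at `c + 1`.
      refine hmin.false_of_splice (g := fun i => g' (s' - i)) (s := s') (w := c + 1) F.hole F.ne h1
        hap hpb (by omega) (by omega) hxb ht'.path.reverse ?_ ?_
        (fun i hi => ht'.ne_center hv hxc (by omega)) ?_
        (fun i hi => tail_spoke ht' (by omega) hxc (s' - i) (by omega))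
        (Or.inl ⟨s', le_rfl, by simpa [ht'.zero] using hxc⟩)
      · intro i hi j hj hjw he
        have := ht'.eq_hole hv F.hole (by omega) (by omega) hj he
        omega
      · intro i hi j hj hjw
        rcases ht'.cases (i := s' - i) (by omega) with ⟨h5, h6⟩ | ⟨h5, h6⟩ | ⟨h5, h6, -⟩
        · rw [h6, F.hole.adj_iff' (by omega) hj]
          omega
        · rw [h6]
          constructor
          · intro hvj
            rcases hjw with hjp | hjw
            · by_cases hj0 : j = 0
              · exact absurd hvj (hR' j hj (Or.inr hj0))
              have h7 : a ≤ j := by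
                by_contra h7
                exact hγ' j (by omega) (by omega) hvj
              have := hpmin j ⟨h7, by omega, hvj⟩
              omega
            · exact absurd hvj (hR' j hj (Or.inl (by omega)))
          · intro h7
            obtain rfl : j = p := by omega
            exact hvp
        · refine ⟨fun h7 => absurd h7 (tail_adj ht' _ h5 h6 j hj (by omega)), by omega⟩
      · intro i hi he
        have := ht'.eq_hole hv F.hole (by omega) (by omega) (by omega) he
        omega
  · have hL' : ∀ j, 0 < j → j < b → ¬ G.Adj v (h j) := by
      intro j h5 h6 h7
      by_cases h8 : a ≤ j
      · exact hL ⟨j, h8, h6, h7⟩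
      · exact hγ' j h5 (by omega) h7
    have hR : ∃ j, c < j ∧ j ≤ n ∧ G.Adj v (h (if j = n then 0 else j)) := by
      by_cases h5 : j₀ = 0
      · subst h5
        exact ⟨n, by omega, le_rfl, by rwa [if_pos rfl]⟩
      · refine ⟨j₀, ?_, hj₀.le, by rwa [if_neg (by omega)]⟩
        rcases hj₀' with h6 | h6
        · exact absurd hvj (hL' j₀ (by omega) h6)
        · exact h6
    obtain ⟨j, hcj, hjn, hvj⟩ := hR
    obtain ⟨w, ⟨hcw, hvw⟩, hwn, hwmax⟩ := exists_isGreatest_of_le (N := n)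
      (P := fun j => c < j ∧ G.Adj v (h (if j = n then 0 else j))) ⟨hcj, hvj⟩ hjn
    -- The hole leaves at `h b`, the first vertex of the tail, and returns from `v` to `h w`; it
    -- loses `h c`.
    refine hmin.false_of_splice (g := g) (s := s) (q := b - 1) (w := w) F.hole F.ne h1
      (by omega) (show b - 1 < c by omega) hcw hwn hxc ht.path ?_ ?_
      (fun i hi => ht.ne_center hv hxb hi) ?_ (fun i hi => tail_spoke ht (by omega) hxb i hi)
      (Or.inl ⟨0, by omega, by rwa [ht.zero]⟩)
    · intro i hi j hj hjw he
      have := ht.eq_hole hv F.hole (by omega) hi hj he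
      omega
    · intro i hi j hj hjw
      rcases ht.cases hi with ⟨h5, h6⟩ | ⟨h5, h6⟩ | ⟨h5, h6, -⟩
      · rw [h6, F.hole.adj_iff' (by omega) hj]
        omega
      · rw [h6]
        constructor
        · intro hvj
          rcases hjw with hjp | hjw
          · by_cases hj0 : j = 0
            · subst hj0
              have := hwmax n le_rfl ⟨by omega, by simpa using hvj⟩
              omega
            · exact absurd hvj (hL' j (by omega) (by omega))
          · have := hwmax j hj.le ⟨by omega, by rwa [if_neg (by omega)]⟩
            omega
        · intro h7
          have h8 : j = if w = n then 0 else w := by split_ifs <;> omega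
          rwa [h8]
      · refine ⟨fun h7 => absurd h7 (tail_adj ht _ h5 h6 j hj (by omega)), by omega⟩
    · intro i hi he
      have := ht.eq_hole hv F.hole (by omega) hi (by omega) he
      omega

/-- If deleting the closed neighbourhood of the center does not disconnect the graph, then some
vertex outside of the wheel is joined by tails to `h b` and to `h c` and has a neighbour on the
hole outside of the sector from `h b` to `h c`. -/
lemma IsFrame.exists_tails (F : G.IsFrame x h n a b c)
    (hcon : (G.induce ({u | u = x ∨ G.Adj x u} : Set V)ᶜ).Preconnected) :
    ∃ v, G.IsOutside x h n v ∧ (∃ g s, G.IsTail x h n b c b g s v) ∧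
      (∃ g s, G.IsTail x h n b c c g s v) ∧ ∃ j < n, G.Adj v (h j) ∧ (j < b ∨ c < j) := by
  classical
  have h1 := F.two_le
  have h2 := F.hab
  have h3 := F.hbc
  have h4 := F.hcn
  have hR : ∀ k < c, k ≠ 0 → k ≠ a → k ≠ b → h k ∈ ({u | u = x ∨ G.Adj x u} : Set V)ᶜ := by
    rintro k hk h5 h6 h7 (h8 | h8)
    · exact F.ne k (by omega) h8
    · have := (F.adj_iff k hk.le).mp h8
      omega
  have hin : ∀ k, b < k → k < c → h k ∈ inner G x h n b c := by
    intro k hbk hkc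
    refine ⟨F.ne k (by omega), fun h5 => hR k hkc (by omega) (by omega) (by omega) (Or.inr h5),
      ?_, ?_⟩
    · intro j hj he
      have := F.hole.inj (by omega) hj he
      omega
    · intro j hj hadj
      rw [F.hole.adj_iff' (by omega) hj] at hadj
      omega
  -- The walk starts inside the sector from `h b` to `h c` and ends inside the first sector, so it
  -- has to leave the inner vertices; the first vertex that is not inner is the desired one.
  obtain ⟨p₀⟩ := hcon ⟨h (b + 1), hR _ (by omega) (by omega) (by omega) (by omega)⟩
    ⟨h 1, hR _ (by omega) (by omega) (by omega) (by omega)⟩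
  obtain ⟨p, hp⟩ := exists_walk_of_induce_walk p₀
  dsimp only at p hp
  have hex : ∃ k, p.getVert k ∉ inner G x h n b c := by
    refine ⟨p.length, fun h5 => ?_⟩
    rw [Walk.getVert_length] at h5
    have := h5.2.2.1 1 (by omega) rfl
    omega
  obtain ⟨k, hk, hkmin⟩ := exists_isLeast_of_pred (P := fun k => p.getVert k ∉ inner G x h n b c) hex.choose_spec
  have hbefore : ∀ i < k, p.getVert i ∈ inner G x h n b c := by
    intro i hi
    by_contra h5
    have := hkmin i h5
    omega
  have hk0 : k ≠ 0 := by
    rintro rfl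
    rw [Walk.getVert_zero] at hk
    exact hk (hin _ (by omega) (by omega))
  have hkR := hp _ (p.getVert_mem_support k)
  have hkR1 : p.getVert k ≠ x := fun h5 => hkR (Or.inl h5)
  have hkR2 : ¬ G.Adj x (p.getVert k) := fun h5 => hkR (Or.inr h5)
  have hklen : k ≤ p.length := hkmin p.length (by
    rw [Walk.getVert_length]
    intro h5
    have := h5.2.2.1 1 (by omega) rfl
    omega)
  have hprev : G.Adj (p.getVert (k - 1)) (p.getVert k) := by
    have := p.adj_getVert_succ (i := k - 1) (by omega)
    rwa [Nat.sub_add_cancel (by omega)] at this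
  -- If this vertex were on the hole, its inner predecessor would force it into the sector from `h
  -- b` to `h c`. It is not a spoke end, so it would be inner itself.
  have hout : ∀ j < n, p.getVert k ≠ h j := by
    intro j hj he
    have h5 := (hbefore (k - 1) (by omega)).2.2.2 j hj (he ▸ hprev)
    rw [he] at hkR2 hk
    refine hk (hin j ?_ ?_)
    · rcases h5.1.lt_or_eq with h6 | rfl
      · exact h6
      · exact absurd ((F.adj_iff b (by omega)).mpr (by omega)) hkR2
    · rcases h5.2.lt_or_eq with h6 | rfl
      · exact h6
      · exact absurd ((F.adj_iff j (by omega)).mpr (by omega)) hkR2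
  have hnbr : ∃ j < n, G.Adj (p.getVert k) (h j) ∧ (j < b ∨ c < j) := by
    by_contra hno
    refine hk ⟨hkR1, hkR2, fun j hj he => absurd he (hout j hj), fun j hj hadj => ?_⟩
    by_contra h5
    exact hno ⟨j, hj, hadj, by omega⟩
  have hpsup : ∀ u ∈ (p.take k).support, u ∈ inner G x h n b c ∨ u = p.getVert k := by
    intro u hu
    obtain ⟨i, hi, hil⟩ := Walk.mem_support_iff_exists_getVert.mp hu
    rw [Walk.take_getVert] at hi
    rw [← hi]
    rcases Nat.lt_or_ge i k with h5 | h5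
    · rw [min_eq_right h5.le]
      exact Or.inl (hbefore i h5)
    · rw [min_eq_left h5]
      exact Or.inr rfl
  have tail : ∀ e (q : G.Walk (h e) (p.getVert k)), e < n →
      (∀ u ∈ q.support, u = h e ∨ u ∈ inner G x h n b c ∨ u = p.getVert k) →
      ∃ g s, G.IsTail x h n b c e g s (p.getVert k) := by
    intro e q he hq
    -- An induced path meets its two ends only once, so all its other vertices are inner.
    obtain ⟨g, s, hg, hg0, hgs, hgX⟩ := exists_isInducedPath_of_walk
      (X := {u | u = h e ∨ u ∈ inner G x h n b c ∨ u = p.getVert k}) q hq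
    refine ⟨g, s, hg, hg0, hgs, fun i hi his => ?_⟩
    rcases hgX i his.le with h5 | h5 | h5
    · have := hg.inj his.le (Nat.zero_le _) (h5.trans hg0.symm)
      omega
    · exact h5
    · have := hg.inj his.le le_rfl (h5.trans hgs.symm)
      omega
  refine ⟨p.getVert k, ⟨hkR1, hkR2, hout⟩, tail b
    (Walk.cons (F.hole.adj_succ (by omega)) (p.take k)) (by omega) ?_, ?_, hnbr⟩
  · intro u hu
    rw [Walk.support_cons, List.mem_cons] at hu
    exact hu.imp_right (hpsup u)
  -- From `h c`, first go back along the hole to `h (b + 1)`, where the walk starts.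
  · have hc : (G.induce (arc h (b + 1) c)).Connected :=
      connected_induce_arc (by omega) fun k _ hk => F.hole.adj_succ (by omega)
    obtain ⟨r, -, hr⟩ := exists_walk_of_connected_induce hc
      (mem_arc (f := h) (show b + 1 ≤ c - 1 by omega) (show c - 1 < c by omega))
      (mem_arc le_rfl (by omega))
    have hadj : G.Adj (h c) (h (c - 1)) := by
      rw [F.hole.adj_iff' (by omega) (by omega)]
      omega
    refine tail c (Walk.cons hadj (r.append (p.take k))) (by omega) ?_
    intro u hu
    rw [Walk.support_cons, List.mem_cons, Walk.mem_support_append_iff] at hu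
    rcases hu with hu | hu | hu
    · exact Or.inl hu
    · obtain ⟨j, hj, hj', rfl⟩ := hr u hu
      exact Or.inr (Or.inl (hin j hj hj'))
    · exact Or.inr (hpsup u hu)

/-- A wheel: a hole and a vertex outside of it with at least three neighbours on the hole. -/
structure IsWheel (G : SimpleGraph V) (x : V) (h : ℕ → V) (n : ℕ) : Prop where
  hole : G.IsHole h n
  ne : ∀ k < n, h k ≠ x
  three : ∃ i j k, i < j ∧ j < k ∧ k < n ∧ G.Adj x (h i) ∧ G.Adj x (h j) ∧ G.Adj x (h k)

lemma IsWheel.lt_ncard [Finite V] (W : G.IsWheel x h n) {S : Set V} (hx : x ∈ S)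
    (hS : ∀ k < n, h k ∈ S) : n + 1 ≤ S.ncard := by
  classical
  have hsub : ((insert x ((Finset.range n).image h) : Finset V) : Set V) ⊆ S := by
    intro v hv
    simp only [Finset.coe_insert, Finset.coe_image, Finset.coe_range, Set.mem_insert_iff,
      Set.mem_image, Set.mem_Iio] at hv
    rcases hv with rfl | ⟨k, hk, rfl⟩
    · exact hx
    · exact hS k hk
  have h1 := Set.ncard_le_ncard hsub (Set.toFinite S)
  rw [Set.ncard_coe_finset, Finset.card_insert_of_notMem, Finset.card_image_of_injOn,
    Finset.card_range] at h1
  · exact h1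
  · intro i hi j hj hij
    exact W.hole.inj (by simpa using hi) (by simpa using hj) hij
  · rintro hmem
    obtain ⟨k, hk, he⟩ := Finset.mem_image.mp hmem
    exact W.ne k (by simpa using hk) he

/-- A shortest wheel, with its first spoke rotated to position `0` and its second one at
position `a`; no vertex has three neighbours on the sector between the two. -/
lemma exists_thin_sector [Finite V] (hfree : G.ISK4Free) (hg : 5 ≤ G.egirth)
    (hsp : ¬ G.IsSeriesParallel) : ∃ x h n a, G.IsHole h n ∧ (∀ k < n, h k ≠ x) ∧ 2 ≤ a ∧
      (∃ e, a < e ∧ e < n ∧ G.Adj x (h e)) ∧ (∀ k ≤ a, G.Adj x (h k) ↔ k = 0 ∨ k = a) ∧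
      ∀ v, v ≠ x → (∀ k ≤ a, v ≠ h k) → ∀ i₁ i₂ i₃, i₁ < i₂ → i₂ < i₃ → i₃ ≤ a →
        G.Adj v (h i₁) → G.Adj v (h i₂) → G.Adj v (h i₃) → False := by
  have hwheel : ∀ S, G.HasK4Minor S →
      ∃ x h n, G.IsWheel x h n ∧ x ∈ S ∧ ∀ k < n, h k ∈ S := by
    intro S hS
    obtain ⟨x, h, n, hh, hx, hk, i, j, k, l, hij, hjk, hkl, hl, ai, aj, ak, -⟩ :=
      exists_wheel_of_hasK4Minor hfree hg hS
    exact ⟨x, h, n, ⟨hh, fun k hkn => (hk k hkn).2, i, j, k, hij, hjk, by omega, ai, aj, ak⟩, hx,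
      fun k hkn => (hk k hkn).1⟩
  obtain ⟨T⟩ := exists_model_of_not_isSeriesParallel hsp
  obtain ⟨x₀, h₀, n₀, W₀, -⟩ := hwheel _ T.hasK4Minor_verts
  -- The shortest wheel is taken over all centers, since the competing wheel below may have another
  -- one.
  obtain ⟨n, ⟨x, h, W⟩, hmin⟩ := exists_isLeast_of_pred (P := fun n => ∃ x h, G.IsWheel x h n)
    ⟨x₀, h₀, W₀⟩
  obtain ⟨hh, hx, i, j, k, hij, hjk, hk, ai, aj, ak⟩ := W
  set f : ℕ → V := fun k => if k + i < n then h (k + i) else h (k + i - n) with hf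
  have hfh : G.IsHole f n := hh.rotate (by omega)
  have hfx : ∀ k < n, f k ≠ x := by
    intro k hk
    simp only [hf]
    split_ifs
    · exact hx _ (by omega)
    · exact hx _ (by omega)
  have hfadj : ∀ l, i ≤ l → l < n → G.Adj x (h l) → G.Adj x (f (l - i)) := by
    intro l hil hl hxl
    simp only [hf]
    rwa [Nat.sub_add_cancel hil, if_pos hl]
  have hf0 : G.Adj x (f 0) := by simpa using hfadj i le_rfl (by omega) ai
  obtain ⟨a, ⟨ha0, hxa⟩, hamin⟩ := exists_isLeast_of_pred (P := fun l => 0 < l ∧ G.Adj x (f l))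
    ⟨show 0 < j - i by omega, hfadj j (by omega) (by omega) aj⟩
  have haj := hamin (j - i) ⟨by omega, hfadj j (by omega) (by omega) aj⟩
  have hxe := hfadj k (by omega) hk ak
  have htri : ∀ l, l + 1 < n → G.Adj x (f l) → ¬ G.Adj x (f (l + 1)) := fun l hl h1 h2 =>
    not_triangle_of_five_le_egirth hg h1 (hfh.adj_succ hl) h2.symm
  have ha2 : 2 ≤ a := by
    by_contra h1
    obtain rfl : a = 1 := by omega
    exact htri 0 (by omega) hf0 hxa
  have hae : a + 2 ≤ k - i := by
    by_contra h1
    have h2 : k - i = a + 1 := by omega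
    rw [h2] at hxe
    exact htri a (by omega) hxa hxe
  refine ⟨x, f, n, a, hfh, hfx, ha2, ⟨k - i, by omega, by omega, hxe⟩, ?_, ?_⟩
  · intro l hl
    constructor
    · intro hxl
      by_contra h1
      have := hamin l ⟨by omega, hxl⟩
      omega
    · rintro (rfl | rfl)
      · exact hf0
      · exact hxa
  · intro v hvx hvf i₁ i₂ i₃ h12 h23 h3 a1 a2 a3
    have cA : ∀ p q, p < q → q ≤ a + 1 → (G.induce (arc f p q)).Connected := fun p q hpq hq =>
      connected_induce_arc hpq fun k _ hk => hfh.adj_succ (by omega)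
    have dvh : ∀ p q, q ≤ a + 1 → v ∉ arc f p q := by
      rintro p q hq ⟨k, hk1, hk2, he⟩
      exact hvf k (by omega) he.symm
    have dxh : ∀ p q, q ≤ a + 1 → x ∉ arc f p q := by
      rintro p q hq ⟨k, hk1, hk2, he⟩
      exact hfx k (by omega) he
    have dhh : ∀ p q r t, q ≤ r → t ≤ a + 1 → ∀ v ∈ arc f p q, v ∉ arc f r t := by
      rintro p q r t hqr ht v ⟨k, hk1, hk2, rfl⟩ ⟨k', hk1', hk2', he⟩
      have := hfh.inj (by omega) (by omega) he
      omega
    -- `x` closes the sector to a cycle, which is cut into three connected parts, each containing a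
    -- neighbour of `v`.
    have hminor := hasK4Minor_of_sets (G := G) {v} (arc f 0 (i₁ + 1)) (arc f (i₁ + 1) (i₂ + 1))
      (arc f (i₂ + 1) (a + 1) ∪ {x}) (connected_induce_singleton v) (cA _ _ (by omega) (by omega))
      (cA _ _ (by omega) (by omega))
      (connected_induce_union_of_adj (cA _ _ (by omega) (by omega)) (connected_induce_singleton x)
        ⟨f a, mem_arc (by omega) (by omega), x, rfl, hxa.symm⟩)
      (by rintro u rfl; exact dvh _ _ (by omega)) (by rintro u rfl; exact dvh _ _ (by omega))
      (by
        rintro u rfl (h1 | h1)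
        · exact dvh _ _ (by omega) h1
        · exact hvx h1)
      (dhh _ _ _ _ le_rfl (by omega))
      (by
        rintro u hu (h1 | rfl)
        · exact dhh _ _ _ _ (by omega) (by omega) u hu h1
        · exact dxh _ _ (by omega) hu)
      (by
        rintro u hu (h1 | rfl)
        · exact dhh _ _ _ _ (by omega) (by omega) u hu h1
        · exact dxh _ _ (by omega) hu)
      ⟨v, rfl, _, mem_arc (by omega) (by omega), a1⟩ ⟨v, rfl, _, mem_arc (by omega) (by omega), a2⟩
      ⟨v, rfl, _, Or.inl (mem_arc (by omega) (by omega)), a3⟩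
      ⟨f i₁, mem_arc (by omega) (by omega), _, mem_arc (by omega) (by omega),
        hfh.adj_succ (by omega)⟩
      ⟨f 0, mem_arc (by omega) (by omega), x, Or.inr rfl, hf0.symm⟩
      ⟨f i₂, mem_arc (by omega) (by omega), _, Or.inl (mem_arc (by omega) (by omega)),
        hfh.adj_succ (by omega)⟩
    obtain ⟨x', h', n', W', hx', hh'⟩ := hwheel _ hminor
    have h1 := W'.lt_ncard hx' hh'
    have h2 := hmin n' ⟨x', h', W'⟩
    classical
    have hsub : ({v} ∪ arc f 0 (i₁ + 1) ∪ arc f (i₁ + 1) (i₂ + 1) ∪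
        (arc f (i₂ + 1) (a + 1) ∪ {x}) : Set V) ⊆
        ((insert v (insert x ((Finset.range (a + 1)).image f)) : Finset V) : Set V) := by
      have key : ∀ l < a + 1, f l ∈
          ((insert v (insert x ((Finset.range (a + 1)).image f)) : Finset V) : Set V) := by
        intro l hl
        simp only [Finset.coe_insert, Finset.coe_image, Finset.coe_range, Set.mem_insert_iff,
          Set.mem_image, Set.mem_Iio]
        exact Or.inr (Or.inr ⟨l, hl, rfl⟩)
      rintro u (((rfl | ⟨l, -, hl, rfl⟩) | ⟨l, -, hl, rfl⟩) | (⟨l, -, hl, rfl⟩ | rfl))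
      · simp
      · exact key l (by omega)
      · exact key l (by omega)
      · exact key l (by omega)
      · simp
    -- At most `a + 3` vertices are involved, so the new hole has length at most `a + 2 ≤ k - i <
    -- n`.
    have h5 := Set.ncard_le_ncard hsub (Set.toFinite _)
    rw [Set.ncard_coe_finset] at h5
    have h6 := Finset.card_insert_le v (insert x ((Finset.range (a + 1)).image f))
    have h7 := Finset.card_insert_le x ((Finset.range (a + 1)).image f)
    have h8 := Finset.card_image_le (s := Finset.range (a + 1)) (f := f)
    rw [Finset.card_range] at h8
    omega

/-- In an ISK4-free graph of girth at least five that is not series-parallel, the closed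
neighbourhood of some vertex is a cutset. -/
theorem exists_isStarCutset [Finite V] (hfree : G.ISK4Free) (hg : 5 ≤ G.egirth)
    (hsp : ¬ G.IsSeriesParallel) : ∃ C : Set V, G.IsStarCutset C := by
  obtain ⟨x, f, n₀, a, hf, hfx, ha2, ⟨e₀, hae₀, he₀n, hxe₀⟩, hfa, hthin⟩ :=
    exists_thin_sector hfree hg hsp
  refine ⟨{u | u = x ∨ G.Adj x u}, fun hcon => ?_, x, Or.inl rfl,
    fun u hu hne => hu.resolve_left hne⟩
  -- Only wheels with the same center and the same thin sector compete, so thinness remains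
  -- available for the chosen hole.
  obtain ⟨t, ⟨h, n, hh, hx, hfh, han, ⟨e, hae, hen, hxe⟩, rfl⟩, hmin⟩ := exists_isLeast_of_pred
    (P := fun t => ∃ h n, G.IsHole h n ∧ (∀ k < n, h k ≠ x) ∧ (∀ k ≤ a, h k = f k) ∧ a < n ∧
      (∃ e, a < e ∧ e < n ∧ G.Adj x (h e)) ∧ (spokes G x h n).ncard = t)
    ⟨f, n₀, hf, hfx, fun _ _ => rfl, by omega, ⟨e₀, hae₀, he₀n, hxe₀⟩, rfl⟩
  have hfew : HasFewestSpokes G x h n a := fun h' n' hh' hx' hfh' han' he' =>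
    hmin _ ⟨h', n', hh', hx', fun k hk => (hfh' k hk).trans (hfh k hk), han', he', rfl⟩
  have hadj : ∀ k ≤ a, G.Adj x (h k) ↔ k = 0 ∨ k = a := fun k hk => by
    rw [hfh k hk]; exact hfa k hk
  have hx0 := (hadj 0 (Nat.zero_le _)).mpr (Or.inl rfl)
  have hxa := (hadj a le_rfl).mpr (Or.inr rfl)
  have htri : ∀ l, l + 1 < n → G.Adj x (h l) → ¬ G.Adj x (h (l + 1)) := fun l hl h1 h2 =>
    not_triangle_of_five_le_egirth hg h1 (hh.adj_succ hl) h2.symm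
  obtain ⟨b, ⟨hab, hxb⟩, hbmin⟩ := exists_isLeast_of_pred (P := fun l => a < l ∧ G.Adj x (h l))
    ⟨hae, hxe⟩
  have hbe := hbmin e ⟨hae, hxe⟩
  -- The fourth spoke lies beyond `h b`, because `h b` is the first spoke end after `h a`; this
  -- makes `c` exist.
  obtain ⟨l, hln, hl0, hla, hlb, hxl⟩ := hh.exists_fourth_spoke hfree hg hx
    (show 0 < a by omega) hab (by omega) hx0 hxa hxb
  have hal : a < l := by
    by_contra h1
    have := (hadj l (by omega)).mp hxl
    omega
  have hbl := hbmin l ⟨hal, hxl⟩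
  obtain ⟨c, ⟨hbc, hxc⟩, hcmin⟩ := exists_isLeast_of_pred (P := fun l => b < l ∧ G.Adj x (h l))
    ⟨show b < l by omega, hxl⟩
  have hcl := hcmin l ⟨by omega, hxl⟩
  have F : G.IsFrame x h n a b c := by
    refine ⟨hh, hx, ha2, ?_, ?_, ?_, ?_⟩
    · by_contra h1
      obtain rfl : b = a + 1 := by omega
      exact htri a (by omega) hxa hxb
    · by_contra h1
      obtain rfl : c = b + 1 := by omega
      exact htri b (by omega) hxb hxc
    · by_contra h1
      obtain rfl : c = n - 1 := by omega
      exact not_triangle_of_five_le_egirth hg hx0 hh.adj_last hxc.symm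
    · intro k hk
      constructor
      · intro hxk
        by_contra h1
        by_cases h2 : k ≤ a
        · have := (hadj k h2).mp hxk
          omega
        have := hbmin k ⟨by omega, hxk⟩
        have := hcmin k ⟨by omega, hxk⟩
        omega
      · rintro (rfl | rfl | rfl | rfl) <;> assumption
  obtain ⟨v, hv, ⟨g, s, ht⟩, ⟨g', s', ht'⟩, j, hj, hvj, hjbc⟩ := F.exists_tails hcon
  refine F.false_of_tails hfree hg hfew ?_ hv ht ht' hj hvj hjbc
  intro i₁ i₂ i₃ h12 h23 h3 a1 a2 a3
  rw [hfh _ (by omega)] at a1 a2 a3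
  exact hthin v hv.ne (fun k hk => hfh k hk ▸ hv.ne_hole k (by omega)) i₁ i₂ i₃ h12 h23 h3 a1 a2 a3

end Main

end SimpleGraph

theorem mainTheorem5 {V : Type*} [Finite V] (G : SimpleGraph V)
    (hfree : G.ISK4Free) (hgirth : 5 ≤ G.egirth) :
    G.IsSeriesParallel ∨ ∃ C : Set V, G.IsStarCutset C := by
  by_cases hsp : G.IsSeriesParallel
  · exact Or.inl hsp
  · exact Or.inr (SimpleGraph.exists_isStarCutset hfree hgirth hsp)
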